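/- A \emph{knot diagram} $D$ on $\Sigma=\mathbb{R}^2$ or $\Sigma=S^2$ is a smooth closed immersed curve in $\Sigma$ whose only multiple points are transverse double points (the \emph{crossings}), together with a choice, at each crossing, of which of the two strands is the overpass. The \emph{regions} of $D$ are the connected components of the complement of the curve in $\Sigma$. At each crossing there are four corners; a corner is \emph{positive} if it is swept counterclockwise from the underpass to the overpass, and \emph{negative} if it is swept clockwise from the underpass to the overpass. (A region never touches a crossing at both a positive and a negative corner.) Let $D$ be a knot diagram with $n\ge 1$ crossings $x_1,\dots,x_n$. The \emph{alternating region choice matrix of the single counting rule} $A_{a1}(D)$ has rows indexed by the crossings and columns indexed by the regions; its entry at $(x_i,R)$ is $1$ if $R$ touches $x_i$ at a positive corner, $-1$ if $R$ touches $x_i$ at a negative corner, and $0$ if $R$ does not touch $x_i$. The \emph{alternating region choice matrix of the double counting rule} $A_{a2}(D)$ has the same entries, except that the entry at $(x_i,R)$ is doubled if $R$ touches $x_i$ at two opposite corners. Then: (1) for every $\mathbf{c}\in\mathbb{Z}^n$ there is an integer vector $\mathbf{u}$, indexed by the regions of $D$ and with finitely many non-zero entries, such that $A_{a1}(D)\mathbf{u}+\mathbf{c}=\mathbf{0}$;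 (2) for every $\mathbf{c}\in\mathbb{Z}^n$ there is an integer vector $\mathbf{u}$, indexed by the regions of $D$ and with finitely many non-zero entries, such that $A_{a2}(D)\mathbf{u}+\mathbf{c}=\mathbf{0}$. -/

import Mathlib

open scoped ContDiff Topology

/-- A subset `carrier` of a normed space together with an oriented area form on its tangent
vectors: `area x v w > 0` means that `w` lies counterclockwise of `v` at the point `x`.
Only the two surfaces `plane` and `sphere` below are used. -/
structure OrientedSurface (E : Type) where
  carrier : Set E
  area : E → E → E → ℝ

/-- The plane `ℝ²` with its usual orientation. -/
noncomputable def plane : OrientedSurface (EuclideanSpace ℝ (Fin 2)) where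
  carrier := Set.univ
  area _ v w := Matrix.det !![v 0, v 1; w 0, w 1]

/-- The unit sphere `S²` in `ℝ³`, oriented by its outward normal. -/
noncomputable def sphere : OrientedSurface (EuclideanSpace ℝ (Fin 3)) where
  carrier := Metric.sphere 0 1
  area x v w := Matrix.det !![x 0, x 1, x 2; v 0, v 1, v 2; w 0, w 1, w 2]

/-- A knot diagram on the surface `S`: a smooth closed immersed curve whose only multiple points
are transverse double points, with over/under information at each double point. -/
structure KnotDiagram {E : Type} [NormedAddCommGroup E] [NormedSpace ℝ E]
    (S : OrientedSurface E) where
  /-- the underlying closed curve, parametrized by the circle `ℝ / ℤ` -/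
  curve : UnitAddCircle → E
  mem_carrier : ∀ s, curve s ∈ S.carrier
  smooth : ContDiff ℝ ∞ (fun t : ℝ => curve (t : UnitAddCircle))
  immersed : ∀ s, deriv (fun h : ℝ => curve (s + (h : UnitAddCircle))) 0 ≠ 0
  transverse : ∀ s t, s ≠ t → curve s = curve t →
    LinearIndependent ℝ ![deriv (fun h : ℝ => curve (s + (h : UnitAddCircle))) 0,
      deriv (fun h : ℝ => curve (t + (h : UnitAddCircle))) 0]
  no_triple : ∀ r s t, curve r = curve s → curve s = curve t → r = s ∨ s = t ∨ r = t
  /-- the parameters at which the curve is the overpass (only its values at the parameters of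
  double points matter) -/
  overParams : Set UnitAddCircle
  over_under : ∀ s t, s ≠ t → curve s = curve t → (s ∈ overParams ↔ t ∉ overParams)

namespace KnotDiagram

variable {E : Type} [NormedAddCommGroup E] [NormedSpace ℝ E] {S : OrientedSurface E}

/-- The velocity vector of the curve at the parameter `s`. -/
noncomputable def velocity (D : KnotDiagram S) (s : UnitAddCircle) : E :=
  deriv (fun h : ℝ => D.curve (s + (h : UnitAddCircle))) 0

/-- A crossing, i.e. a double point, recorded by the parameters of its overpass and of its
underpass. -/
@[ext]
structure Crossing (D : KnotDiagram S) where
  overParam : UnitAddCircle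
  underParam : UnitAddCircle
  ne : overParam ≠ underParam
  curve_eq : D.curve overParam = D.curve underParam
  over_mem : overParam ∈ D.overParams

/-- The regions: the connected components of the complement of the curve in the surface. -/
def Region (D : KnotDiagram S) : Type :=
  {R : Set E // ∃ y ∈ S.carrier \ Set.range D.curve,
    R = connectedComponentIn (S.carrier \ Set.range D.curve) y}

variable {D : KnotDiagram S}

/-- The point of the surface at which a crossing lies. -/
def Crossing.point (x : D.Crossing) : E := D.curve x.overParam

/-- One of the two rays of the underpass at a crossing, selected by a sign. -/
noncomputable def Crossing.underRay (x : D.Crossing) (ε : ℤˣ) : E :=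
  ε • D.velocity x.underParam

/-- One of the two rays of the overpass at a crossing, selected by a sign. -/
noncomputable def Crossing.overRay (x : D.Crossing) (δ : ℤˣ) : E :=
  δ • D.velocity x.overParam

/-- The four corners at a crossing `x` are indexed by a ray `ε` of the underpass and a ray `δ` of
the overpass. The region `R` touches `x` at the corner `(ε, δ)` if some curve that starts at `x`
with an initial velocity strictly between these two rays runs in `R` for small positive times. -/
def Region.TouchesAt (R : D.Region) (x : D.Crossing) (ε δ : ℤˣ) : Prop :=
  ∃ (η : ℝ → E) (a b : ℝ), 0 < a ∧ 0 < b ∧ η 0 = x.point ∧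
    HasDerivWithinAt η (a • x.underRay ε + b • x.overRay δ) (Set.Ici 0) 0 ∧
    ∀ᶠ t in 𝓝[>] (0 : ℝ), η t ∈ R.1

/-- The corner `(ε, δ)` is swept counterclockwise from the underpass to the overpass. -/
def Crossing.IsPosCorner (x : D.Crossing) (ε δ : ℤˣ) : Prop :=
  0 < S.area x.point (x.underRay ε) (x.overRay δ)

/-- The corner `(ε, δ)` is swept clockwise from the underpass to the overpass. -/
def Crossing.IsNegCorner (x : D.Crossing) (ε δ : ℤˣ) : Prop :=
  S.area x.point (x.underRay ε) (x.overRay δ) < 0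

/-- `R` touches `x` twice, namely at two opposite corners. -/
def Region.TouchesTwice (R : D.Region) (x : D.Crossing) : Prop :=
  ∃ ε δ : ℤˣ, R.TouchesAt x ε δ ∧ R.TouchesAt x (-ε) (-δ)

open Classical in
/-- The entry of the alternating matrix of the single counting rule. -/
noncomputable def entrySingle (x : D.Crossing) (R : D.Region) : ℤ :=
  if ∃ ε δ : ℤˣ, x.IsPosCorner ε δ ∧ R.TouchesAt x ε δ then 1
  else if ∃ ε δ : ℤˣ, x.IsNegCorner ε δ ∧ R.TouchesAt x ε δ then -1
  else 0

open Classical in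
/-- The entry of the alternating matrix of the double counting rule. -/
noncomputable def entryDouble (x : D.Crossing) (R : D.Region) : ℤ :=
  if R.TouchesTwice x then 2 * entrySingle x R else entrySingle x R

/-- The alternating region choice matrix of the single counting rule, for an enumeration `x` of
the crossings; the columns are indexed by the regions. -/
noncomputable def alternatingSingle (D : KnotDiagram S) {n : ℕ} (x : Fin n ≃ D.Crossing) :
    Matrix (Fin n) D.Region ℤ :=
  Matrix.of fun i R => entrySingle (x i) R

/-- The alternating region choice matrix of the double counting rule. -/
noncomputable def alternatingDouble (D : KnotDiagram S) {n : ℕ} (x : Fin n ≃ D.Crossing) :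
    Matrix (Fin n) D.Region ℤ :=
  Matrix.of fun i R => entryDouble (x i) R

end KnotDiagram

/-- The product `A u` of an integer matrix with a finitely supported integer vector. -/
noncomputable def matMul {I J : Type} (A : Matrix I J ℤ) (u : J →₀ ℤ) : I → ℤ :=
  fun i => u.sum fun j k => A i j * k

/-! A crossing `z` cuts the closed curve at its two parameters; the arc between them is a loop, and
the winding number of this loop about the regions is an integer vector. Passing across a strand of
the curve changes it by a sign depending only on the orientations if the strand belongs to the loop,
and leaves it unchanged otherwise.

Double rule. Adjacent corners of a crossing lie in different regions, so the row of `x` applied to a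
vector `w` is, up to sign, the alternating sum of `w` over the four corners of `x`. At a crossing `x
≠ z` each strand lies wholly inside or wholly outside the loop of `z`, and the alternating sum
vanishes (`loopWind_alternating`). At `z` the loop turns a corner: three corners have the same
winding number and the fourth differs by `±1` (`loopWind_self`). The vector of `z` is therefore
mapped to plus or minus the unit vector of `z`.

Single rule. Only the rows of reducible crossings change, those touched by one region at opposite
corners. The vector is normalized to vanish at three corners of `z`, so the entry at `z` is still a
unit. A reducible crossing is not interleaved with any other crossing (`Reducible.not_interleaved`),
so the rest of the curve misses its loop (`Reducible.path_notMem`) and the normalized winding number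
vanishes at every crossing outside that loop. Among reducible crossings the system is thus
triangular for nesting of loops, and the remaining crossings are solved modulo the reducible ones
(`submodule_eq_top_of_triangular`).

The sphere is reduced to the plane by stereographic projection from a point off the curve, about
which every winding number is set to be zero. -/

/-! ### Winding numbers of closed `C¹` curves in the complex plane. -/

section

open Set Filter Complex

/-- The restriction of the `C¹` curve `g` to `[a, b]` is a closed curve. -/
structure IsLoop (g : ℝ → ℂ) (a b : ℝ) : Prop where
  smooth : ContDiff ℝ 1 g
  lt : a < b
  closed : g a = g b

/-- The logarithmic integral of the curve `g` on `[a, b]` about the point `z`. -/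
noncomputable def logIntegral (g : ℝ → ℂ) (a b : ℝ) (z : ℂ) : ℂ :=
  ∫ t in a..b, deriv g t / (g t - z)

/-- The winding number of the loop `g` on `[a, b]` about the point `z`. -/
noncomputable def wind (g : ℝ → ℂ) (a b : ℝ) (z : ℂ) : ℤ :=
  round (logIntegral g a b z / (2 * Real.pi * I)).re

namespace IsLoop

variable {g : ℝ → ℂ} {a b : ℝ}

lemma hasDerivAt (h : IsLoop g a b) (t : ℝ) : HasDerivAt g (deriv g t) t :=
  (h.smooth.differentiable one_ne_zero t).hasDerivAt

lemma continuous_deriv (h : IsLoop g a b) : Continuous (deriv g) :=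
  h.smooth.continuous_deriv le_rfl

lemma sub_ne_zero {z : ℂ} (hz : z ∉ g '' Icc a b) {t : ℝ} (ht : t ∈ Icc a b) : g t - z ≠ 0 :=
  fun h0 => hz ⟨t, ht, _root_.sub_eq_zero.1 h0⟩

lemma continuousOn_integrand (h : IsLoop g a b) {z : ℂ} (hz : z ∉ g '' Icc a b) :
    ContinuousOn (fun t => deriv g t / (g t - z)) (Icc a b) :=
  h.continuous_deriv.continuousOn.div (h.smooth.continuous.sub continuous_const).continuousOn
    fun _ ht => sub_ne_zero hz ht

/-- The product of `g - z` with the exponential of minus its logarithmic integral has derivative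
zero; compare its values at the two ends, where `g` takes the same value. -/
lemma exp_logIntegral (h : IsLoop g a b) {z : ℂ} (hz : z ∉ g '' Icc a b) :
    exp (logIntegral g a b z) = 1 := by
  set f : ℝ → ℂ := fun t => deriv g t / (g t - z)
  -- Outside `[a, b]` the curve may pass through `z`. Extending the integrand by its end values
  -- keeps it continuous, so that its integral is differentiable everywhere.
  set k : ℝ → ℂ := IccExtend h.lt.le ((Icc a b).domRestrict f)
  have hk : Continuous k :=
    (continuousOn_iff_continuous_domRestrict.1 (h.continuousOn_integrand hz)).Icc_extend'
  have hkf : ∀ t ∈ Icc a b, k t = f t := fun t ht => by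
    simp only [k, IccExtend_of_mem _ _ ht, domRestrict_apply]
  have hF : ∀ t, HasDerivAt (fun t => ∫ s in a..t, k s) (k t) t := fun t =>
    (hk.integral_hasStrictDerivAt a t).hasDerivAt
  have hG : ∀ t, HasDerivAt (fun t => exp (-∫ s in a..t, k s) * (g t - z))
      (exp (-∫ s in a..t, k s) * (-k t) * (g t - z) + exp (-∫ s in a..t, k s) * deriv g t) t :=
    fun t => ((hF t).neg.cexp).mul ((h.hasDerivAt t).sub_const z)
  have hc := constant_of_has_deriv_right_zero (a := a) (b := b)
    (fun t _ => (hG t).continuousAt.continuousWithinAt) (fun t ht => by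
      have h0 := sub_ne_zero hz (Ico_subset_Icc_self ht)
      have := (hG t).hasDerivWithinAt (s := Ici t)
      convert! this using 1
      rw [hkf t (Ico_subset_Icc_self ht)]
      simp only [f]
      field_simp
      ring) b (right_mem_Icc.2 h.lt.le)
  have h0 := sub_ne_zero hz (left_mem_Icc.2 h.lt.le)
  have hI : logIntegral g a b z = ∫ s in a..b, k s :=
    intervalIntegral.integral_congr fun t ht => by
      rw [uIcc_of_le h.lt.le] at ht
      exact (hkf t ht).symm
  simp only [intervalIntegral.integral_same, neg_zero, exp_zero, one_mul, ← h.closed] at hc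
  have h1 : exp (-logIntegral g a b z) = 1 := by
    rw [hI]
    exact mul_right_cancel₀ h0 (by rw [hc, one_mul])
  rw [exp_neg] at h1
  exact inv_eq_one.1 h1

lemma logIntegral_eq (h : IsLoop g a b) {z : ℂ} (hz : z ∉ g '' Icc a b) :
    logIntegral g a b z = wind g a b z * (2 * Real.pi * I) := by
  obtain ⟨n, hn⟩ := exp_eq_one_iff.1 (h.exp_logIntegral hz)
  have h0 : (2 * Real.pi * I : ℂ) ≠ 0 := two_pi_I_ne_zero
  have : wind g a b z = n := by
    rw [wind, hn, mul_div_cancel_right₀ _ h0, intCast_re, round_intCast]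
  rw [this, hn]

lemma isClosed_image (h : IsLoop g a b) : IsClosed (g '' Icc a b) :=
  (isCompact_Icc.image h.smooth.continuous).isClosed

/-- Dominated convergence: if the ball of radius `r` about `z` misses the loop, the integrand is
bounded by `C / (r / 2)` for all points of the half ball. -/
lemma continuousAt_logIntegral (h : IsLoop g a b) {z : ℂ} (hz : z ∉ g '' Icc a b) :
    ContinuousAt (logIntegral g a b) z := by
  obtain ⟨r, hr, hball⟩ := Metric.isOpen_iff.1 h.isClosed_image.isOpen_compl z hz
  obtain ⟨C, hC⟩ := isCompact_Icc.exists_bound_of_continuousOn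
    (h.continuous_deriv.continuousOn (s := Icc a b))
  have hnear : ∀ᶠ w in 𝓝 z, w ∈ Metric.ball z (r / 2) := Metric.ball_mem_nhds z (by positivity)
  have hdist : ∀ w ∈ Metric.ball z (r / 2), ∀ t ∈ Icc a b, r / 2 ≤ ‖g t - w‖ := by
    intro w hw t ht
    have h1 : r ≤ dist (g t) z := by
      by_contra hlt
      exact hball (Metric.mem_ball.2 (not_le.1 hlt)) ⟨t, ht, rfl⟩
    have h2 := dist_triangle (g t) w z
    rw [Metric.mem_ball] at hw
    rw [← dist_eq_norm]
    linarith
  have hioc : uIoc a b ⊆ Icc a b := by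
    rw [uIoc_of_le h.lt.le]
    exact Ioc_subset_Icc_self
  refine intervalIntegral.continuousAt_of_dominated_interval (bound := fun _ => C / (r / 2))
    ?_ ?_ (by simp) ?_
  · filter_upwards [hnear] with w hw
    have hw' : w ∉ g '' Icc a b := fun hmem => by
      refine hball (Metric.ball_subset_ball (by linarith) hw) hmem
    exact ((h.continuousOn_integrand hw').mono hioc).aestronglyMeasurable measurableSet_uIoc
  · filter_upwards [hnear] with w hw
    refine Eventually.of_forall fun t ht => ?_
    rw [norm_div]
    exact div_le_div₀ ((norm_nonneg _).trans (hC t (hioc ht))) (hC t (hioc ht)) (by positivity)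
      (hdist w hw t (hioc ht))
  · refine Eventually.of_forall fun t ht => ?_
    exact continuousAt_const.div (continuousAt_const.sub continuousAt_id)
      (sub_ne_zero hz (hioc ht))

lemma wind_eventually_eq (h : IsLoop g a b) {z : ℂ} (hz : z ∉ g '' Icc a b) :
    ∀ᶠ w in 𝓝 z, wind g a b w = wind g a b z := by
  have h0 : (2 * Real.pi * I : ℂ) ≠ 0 := two_pi_I_ne_zero
  have hc : ContinuousAt (fun w => logIntegral g a b w / (2 * Real.pi * I)) z :=
    (h.continuousAt_logIntegral hz).div_const _
  filter_upwards [h.isClosed_image.isOpen_compl.mem_nhds hz, hc (Metric.ball_mem_nhds _ one_pos)]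
    with w hw hw1
  rw [mem_preimage, Metric.mem_ball, h.logIntegral_eq hz, h.logIntegral_eq hw,
    mul_div_cancel_right₀ _ h0, mul_div_cancel_right₀ _ h0, dist_eq_norm, ← Int.cast_sub,
    norm_intCast, ← Int.cast_abs] at hw1
  have : |wind g a b w - wind g a b z| < 1 := by exact_mod_cast hw1
  rw [Int.abs_lt_one_iff] at this
  omega

lemma wind_eq_of_isPreconnected (h : IsLoop g a b) {s : Set ℂ} (hs : IsPreconnected s)
    (hd : ∀ z ∈ s, z ∉ g '' Icc a b) {z w : ℂ} (hz : z ∈ s) (hw : w ∈ s) :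
    wind g a b z = wind g a b w :=
  hs.constant (f := wind g a b)
    (fun x hx => by
      have : ContinuousAt (wind g a b) x := by
        rw [ContinuousAt, nhds_discrete ℤ, tendsto_pure]
        exact h.wind_eventually_eq (hd x hx)
      exact this.continuousWithinAt) hz hw

/-- Far away the logarithmic integral has norm less than `1`, while a nonzero winding number would
make it at least `2π`. -/
lemma wind_eventually_zero (h : IsLoop g a b) :
    ∀ᶠ z in Bornology.cobounded ℂ, wind g a b z = 0 := by
  obtain ⟨C, hC⟩ := isCompact_Icc.exists_bound_of_continuousOn
    (h.continuous_deriv.continuousOn (s := Icc a b))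
  obtain ⟨M, hM⟩ := isCompact_Icc.exists_bound_of_continuousOn
    (h.smooth.continuous.continuousOn (s := Icc a b))
  have hC0 : 0 ≤ C := (norm_nonneg _).trans (hC a (left_mem_Icc.2 h.lt.le))
  have hba : 0 < b - a := sub_pos.2 h.lt
  filter_upwards [tendsto_norm_cobounded_atTop.eventually_gt_atTop (M + (C * (b - a) + 1))]
    with z hz
  have hd : ∀ t ∈ Icc a b, C * (b - a) + 1 ≤ ‖g t - z‖ := fun t ht => by
    have := norm_sub_norm_le z (g t)
    rw [norm_sub_rev] at this
    linarith [hM t ht]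
  have hz' : z ∉ g '' Icc a b := by
    rintro ⟨t, ht, rfl⟩
    have := hd t ht
    rw [sub_self, norm_zero] at this
    nlinarith
  have hb : ‖logIntegral g a b z‖ ≤ C / (C * (b - a) + 1) * |b - a| := by
    refine intervalIntegral.norm_integral_le_of_norm_le_const fun t ht => ?_
    have ht' : t ∈ Icc a b := by
      rw [uIoc_of_le h.lt.le] at ht
      exact Ioc_subset_Icc_self ht
    rw [norm_div]
    exact div_le_div₀ hC0 (hC t ht') (by positivity) (hd t ht')
  rw [abs_of_pos hba, div_mul_eq_mul_div] at hb
  have hlt : ‖logIntegral g a b z‖ < 1 :=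
    hb.trans_lt ((div_lt_one (by positivity)).2 (by linarith))
  by_contra hne
  have h1 : (1 : ℝ) ≤ |(wind g a b z : ℝ)| := by exact_mod_cast Int.one_le_abs hne
  rw [h.logIntegral_eq hz', norm_mul, norm_intCast] at hlt
  have h2 : ‖(2 * Real.pi * I : ℂ)‖ = 2 * Real.pi := by
    simp [abs_of_pos Real.pi_pos]
  rw [h2] at hlt
  nlinarith [Real.pi_gt_three]

/-- The jump of the winding number across an arc of the loop. -/
lemma wind_sub_wind (h : IsLoop g a b) {z₁ z₂ : ℂ} (h₁ : z₁ ∉ g '' Icc a b)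
    (h₂ : z₂ ∉ g '' Icc a b) {c : ℝ} (hc : c ∈ Ioo a b)
    (hslit : ∀ t ∈ Icc a b, t ≠ c → (g t - z₁) / (g t - z₂) ∈ slitPlane)
    (hre : ((g c - z₁) / (g c - z₂)).re < 0) (him : ((g c - z₁) / (g c - z₂)).im = 0)
    (hleft : ∀ᶠ t in 𝓝[<] c, 0 < ((g t - z₁) / (g t - z₂)).im)
    (hright : ∀ᶠ t in 𝓝[>] c, ((g t - z₁) / (g t - z₂)).im < 0) :
    wind g a b z₁ - wind g a b z₂ = 1 := by
  -- The difference `f` of the two integrands is the logarithmic derivative of `ρ`. The principal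
  -- logarithm is a primitive on either side of `c`; its one-sided limits at `c` are `±πi` plus a
  -- common real part, and the terms at `a` and `b` cancel because `ρ a = ρ b`.
  set ρ : ℝ → ℂ := fun t => (g t - z₁) / (g t - z₂) with hρ
  set f : ℝ → ℂ := fun t => deriv g t / (g t - z₁) - deriv g t / (g t - z₂) with hf
  have hint : ∀ {z}, z ∉ g '' Icc a b →
      IntervalIntegrable (fun t => deriv g t / (g t - z)) MeasureTheory.volume a b := fun hz =>
    (h.continuousOn_integrand hz).intervalIntegrable_of_Icc h.lt.le
  have hfint : IntervalIntegrable f MeasureTheory.volume a b := (hint h₁).sub (hint h₂)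
  have hac : IntervalIntegrable f MeasureTheory.volume a c :=
    hfint.mono_set (by
      rw [uIcc_of_le h.lt.le, uIcc_of_le hc.1.le]; exact Icc_subset_Icc_right hc.2.le)
  have hcb : IntervalIntegrable f MeasureTheory.volume c b :=
    hfint.mono_set (by
      rw [uIcc_of_le h.lt.le, uIcc_of_le hc.2.le]; exact Icc_subset_Icc_left hc.1.le)
  have hρc : ∀ t ∈ Icc a b, ContinuousAt ρ t := fun t ht =>
    (h.hasDerivAt t).continuousAt.sub continuousAt_const |>.div
      ((h.hasDerivAt t).continuousAt.sub continuousAt_const) (sub_ne_zero h₂ ht)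
  have hlog : ∀ t ∈ Icc a b, t ≠ c → HasDerivAt (fun t => log (ρ t)) (f t) t := by
    intro t ht htc
    have e₁ := sub_ne_zero h₁ ht
    have e₂ := sub_ne_zero h₂ ht
    have := (((h.hasDerivAt t).sub_const z₁).div ((h.hasDerivAt t).sub_const z₂) e₂).clog_real
      (hslit t ht htc)
    convert! this using 1
    simp only [hf, Pi.div_apply]
    field_simp
  have ha : a ∈ Icc a b := left_mem_Icc.2 h.lt.le
  have hb : b ∈ Icc a b := right_mem_Icc.2 h.lt.le
  have hc' : c ∈ Icc a b := Ioo_subset_Icc_self hc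
  have hL : Tendsto (fun t => log (ρ t)) (𝓝[<] c) (𝓝 (Real.log ‖ρ c‖ + Real.pi * I)) := by
    refine (tendsto_log_nhdsWithin_im_nonneg_of_re_neg_of_im_zero hre him).comp ?_
    exact tendsto_nhdsWithin_iff.2 ⟨(hρc c hc').continuousWithinAt.tendsto,
      hleft.mono fun t ht => ht.le⟩
  have hR : Tendsto (fun t => log (ρ t)) (𝓝[>] c) (𝓝 (Real.log ‖ρ c‖ - Real.pi * I)) := by
    refine (tendsto_log_nhdsWithin_im_neg_of_re_neg_of_im_zero hre him).comp ?_
    exact tendsto_nhdsWithin_iff.2 ⟨(hρc c hc').continuousWithinAt.tendsto, hright⟩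
  have i₁ := intervalIntegral.integral_eq_sub_of_hasDerivAt_of_tendsto hc.1
    (fun t ht => hlog t ⟨ht.1.le, ht.2.le.trans hc.2.le⟩ ht.2.ne) hac
    ((hlog a ha hc.1.ne).continuousAt.continuousWithinAt.tendsto) hL
  have i₂ := intervalIntegral.integral_eq_sub_of_hasDerivAt_of_tendsto hc.2
    (fun t ht => hlog t ⟨hc.1.le.trans ht.1.le, ht.2.le⟩ ht.1.ne') hcb hR
    ((hlog b hb hc.2.ne').continuousAt.continuousWithinAt.tendsto)
  have itot : logIntegral g a b z₁ - logIntegral g a b z₂ = 2 * Real.pi * I := by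
    rw [logIntegral, logIntegral, ← intervalIntegral.integral_sub (hint h₁) (hint h₂)]
    change (∫ t in a..b, f t) = _
    rw [← intervalIntegral.integral_add_adjacent_intervals hac hcb, i₁, i₂]
    simp only [hρ, ← h.closed]
    ring
  rw [h.logIntegral_eq h₁, h.logIntegral_eq h₂, ← sub_mul] at itot
  have h0 : (2 * Real.pi * I : ℂ) ≠ 0 := two_pi_I_ne_zero
  have : ((wind g a b z₁ - wind g a b z₂ : ℤ) : ℂ) = 1 := by
    push_cast
    exact mul_right_cancel₀ h0 (by rw [itot, one_mul])
  exact_mod_cast this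

end IsLoop

end

/-! ### Local geometry of a plane curve at a transverse double point. -/

section

open Set Filter Complex

/-- The area form of the plane. -/
def cross (z w : ℂ) : ℝ := z.re * w.im - z.im * w.re

/-- The `v`-coordinate of `z` with respect to the basis `v, u` of the plane. -/
noncomputable def along (v u z : ℂ) : ℝ := cross z u / cross v u

lemma cross_swap (z w : ℂ) : cross z w = -cross w z := by simp [cross]; ring

lemma along_add (v u z w : ℂ) : along v u (z + w) = along v u z + along v u w := by
  simp [along, cross]; ring

lemma along_ofReal_mul (v u : ℂ) (r : ℝ) (z : ℂ) : along v u (r * z) = r * along v u z := by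
  simp [along, cross]; ring

lemma along_zero (v u : ℂ) : along v u 0 = 0 := by simp [along, cross]

lemma along_self {v u : ℂ} (h : cross v u ≠ 0) : along v u v = 1 := div_self h

lemma along_other (v u : ℂ) : along v u u = 0 := by simp [along, cross]; left; ring

lemma eq_along {v u : ℂ} (h : cross v u ≠ 0) (z : ℂ) :
    z = along v u z * v + along u v z * u := by
  have h' : cross u v ≠ 0 := by rw [cross_swap]; exact neg_ne_zero.2 h
  have e : along u v z = cross v z / cross v u := by
    rw [along, cross_swap u v, cross_swap z v, neg_div_neg_eq]
  rw [e, along]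
  apply Complex.ext
  · simp only [add_re, re_ofReal_mul]
    field_simp
    simp only [cross]
    ring
  · simp only [add_im, im_ofReal_mul]
    field_simp
    simp only [cross]
    ring

lemma HasDerivAt.along {v u : ℂ} {g : ℝ → ℂ} {g' : ℂ} {x : ℝ} (hg : HasDerivAt g g' x) (p : ℂ) :
    HasDerivAt (fun t => along v u (g t - p)) (_root_.along v u g') x := by
  have h := hg.sub_const p
  have hre := (reCLM.hasFDerivAt.comp_hasDerivAt x h)
  have him := (imCLM.hasFDerivAt.comp_hasDerivAt x h)
  exact ((hre.mul_const u.im).sub (him.mul_const u.re)).div_const (cross v u)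

/-- The periodic curve `g` has a transverse double point, at exactly the parameters `s` and `t`
modulo the period. -/
structure IsDoublePoint (g : ℝ → ℂ) (s t : ℝ) : Prop where
  smooth : ContDiff ℝ 1 g
  periodic : Function.Periodic g 1
  eq : g s = g t
  only : ∀ r, g r = g s → (∃ k : ℤ, r = s + k) ∨ ∃ k : ℤ, r = t + k
  indep : cross (deriv g s) (deriv g t) ≠ 0

/-- A point on a ray from the double point into the corner `(ε, δ)`. -/
noncomputable def cornerPoint (g : ℝ → ℂ) (s t : ℝ) (ε δ : ℤˣ) (h : ℝ) : ℂ :=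
  g s + h * (((ε : ℤ) : ℂ) * deriv g s + ((δ : ℤ) : ℂ) * deriv g t)

namespace IsDoublePoint

variable {g : ℝ → ℂ} {s t : ℝ}

lemma symm (h : IsDoublePoint g s t) : IsDoublePoint g t s where
  smooth := h.smooth
  periodic := h.periodic
  eq := h.eq.symm
  only r hr := (h.only r (hr.trans h.eq.symm)).symm
  indep := by rw [cross_swap]; exact neg_ne_zero.2 h.indep

lemma cornerPoint_symm (h : IsDoublePoint g s t) (ε δ : ℤˣ) :
    cornerPoint g t s ε δ = cornerPoint g s t δ ε := by
  funext x
  simp only [cornerPoint, h.eq]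
  ring

lemma hasDerivAt (h : IsDoublePoint g s t) (r : ℝ) : HasDerivAt g (deriv g r) r :=
  (h.smooth.differentiable one_ne_zero r).hasDerivAt

lemma apply_add_int (h : IsDoublePoint g s t) (r : ℝ) (k : ℤ) : g (r + k) = g r := by
  simpa using h.periodic.int_mul k r

/-- Compactness: on the parameters in `[0, 1]` at distance at least `r` from all translates of `s`
and `t`, the continuous function `‖g - g s‖` has no zero, hence has a positive lower bound. -/
lemma near_params (h : IsDoublePoint g s t) {r : ℝ} (hr : 0 < r) :
    ∃ m > 0, ∀ τ, ‖g τ - g s‖ < m →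
      (∃ k : ℤ, |τ - k - s| < r) ∨ ∃ k : ℤ, |τ - k - t| < r := by
  set C : Set ℝ := Icc 0 1 ∩ ⋂ k : ℤ, ({τ | r ≤ |τ - k - s|} ∩ {τ | r ≤ |τ - k - t|}) with hC
  have hcomp : IsCompact C := by
    refine isCompact_Icc.inter_right (isClosed_iInter fun k => IsClosed.inter ?_ ?_)
    · exact isClosed_le continuous_const (by fun_prop)
    · exact isClosed_le continuous_const (by fun_prop)
  have hpos : ∀ τ ∈ C, 0 < ‖g τ - g s‖ := by
    rintro τ ⟨-, hτ⟩
    rw [mem_iInter] at hτ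
    rw [norm_pos_iff, sub_ne_zero]
    intro he
    rcases h.only τ he with ⟨k, rfl⟩ | ⟨k, rfl⟩
    · have := (hτ k).1
      simp at this
      linarith
    · have := (hτ k).2
      simp at this
      linarith
  obtain ⟨m, hm, hmC⟩ : ∃ m > 0, ∀ τ ∈ C, m ≤ ‖g τ - g s‖ :=
    hcomp.exists_forall_le' (by have := h.smooth.continuous; fun_prop) hpos
  refine ⟨m, hm, fun τ hτ => ?_⟩
  by_contra hcon
  simp only [not_or, not_exists, not_lt] at hcon
  have hf : g (Int.fract τ) = g τ := by
    rw [← h.apply_add_int (Int.fract τ) ⌊τ⌋, Int.fract_add_floor]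
  have : Int.fract τ ∈ C := by
    refine ⟨⟨Int.fract_nonneg τ, (Int.fract_lt_one τ).le⟩, mem_iInter.2 fun k => ⟨?_, ?_⟩⟩
    · have := hcon.1 (k + ⌊τ⌋)
      rwa [Int.cast_add, add_comm (k : ℝ), ← sub_sub τ] at this
    · have := hcon.2 (k + ⌊τ⌋)
      rwa [Int.cast_add, add_comm (k : ℝ), ← sub_sub τ] at this
  have := hmC _ this
  rw [hf] at this
  linarith

/-- In the basis of the two tangent vectors the coordinates of `g` have derivatives `1` and `0` at
`s`. -/
lemma strand (h : IsDoublePoint g s t) {κ : ℝ} (hκ : 0 < κ) : ∃ r > 0, ∀ c, |c| < r →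
    |along (deriv g s) (deriv g t) (g (s + c) - g s) - c| ≤ κ * |c| ∧
    |along (deriv g t) (deriv g s) (g (s + c) - g s)| ≤ κ * |c| := by
  have h₁ := (h.hasDerivAt s).along (v := deriv g s) (u := deriv g t) (g s)
  have h₂ := (h.hasDerivAt s).along (v := deriv g t) (u := deriv g s) (g s)
  rw [along_self h.indep, hasDerivAt_iff_isLittleO_nhds_zero] at h₁
  rw [along_other, hasDerivAt_iff_isLittleO_nhds_zero] at h₂
  have := (h₁.def hκ).and (h₂.def hκ)
  rw [Metric.eventually_nhds_iff] at this
  obtain ⟨r, hr, hh⟩ := this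
  refine ⟨r, hr, fun c hc => ?_⟩
  have := hh (y := c) (by simpa using hc)
  simpa only [sub_self, along_zero, sub_zero, smul_eq_mul, mul_one, mul_zero, Real.norm_eq_abs]
    using this

/-- Near a double point, the curve stays close to the two tangent lines. -/
lemma near_tangents (h : IsDoublePoint g s t) {κ r : ℝ} (hκ : 0 < κ) (hr : 0 < r) :
    ∃ η > 0, ∀ τ, |along (deriv g s) (deriv g t) (g τ - g s)| < η →
      |along (deriv g t) (deriv g s) (g τ - g s)| < η →
      (∃ k : ℤ, |τ - k - s| < r ∧
        |along (deriv g s) (deriv g t) (g τ - g s) - (τ - k - s)| ≤ κ * |τ - k - s| ∧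
        |along (deriv g t) (deriv g s) (g τ - g s)| ≤ κ * |τ - k - s|) ∨
      ∃ k : ℤ, |τ - k - t| < r ∧
        |along (deriv g t) (deriv g s) (g τ - g s) - (τ - k - t)| ≤ κ * |τ - k - t| ∧
        |along (deriv g s) (deriv g t) (g τ - g s)| ≤ κ * |τ - k - t| := by
  obtain ⟨r₁, hr₁, h₁⟩ := h.strand hκ
  obtain ⟨r₂, hr₂, h₂⟩ := h.symm.strand hκ
  obtain ⟨m, hm, hnear⟩ := h.near_params (lt_min hr (lt_min hr₁ hr₂))
  have hL : 0 < ‖deriv g s‖ + ‖deriv g t‖ + 1 := by positivity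
  -- If both coordinates are smaller than this bound, the triangle inequality gives `‖g τ - g s‖ <
  -- m`; the summand `1` keeps the denominator positive.
  refine ⟨m / (‖deriv g s‖ + ‖deriv g t‖ + 1), by positivity, fun τ hA hB => ?_⟩
  have hlt : ‖g τ - g s‖ < m := by
    rw [lt_div_iff₀ hL] at hA hB
    set A := along (deriv g s) (deriv g t) (g τ - g s) with hA'
    set B := along (deriv g t) (deriv g s) (g τ - g s) with hB'
    have e := eq_along h.indep (g τ - g s)
    rw [← hA', ← hB'] at e
    have n1 : ‖g τ - g s‖ ≤ |A| * ‖deriv g s‖ + |B| * ‖deriv g t‖ := by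
      rw [e]
      refine (norm_add_le _ _).trans ?_
      rw [norm_mul, norm_mul, norm_real, norm_real, Real.norm_eq_abs, Real.norm_eq_abs]
    have hmax : max |A| |B| * (‖deriv g s‖ + ‖deriv g t‖ + 1) < m := by
      rcases max_cases |A| |B| with ⟨e, -⟩ | ⟨e, -⟩ <;> rw [e] <;> assumption
    have p1 := mul_le_mul_of_nonneg_right (le_max_left |A| |B|) (norm_nonneg (deriv g s))
    have p2 := mul_le_mul_of_nonneg_right (le_max_right |A| |B|) (norm_nonneg (deriv g t))
    have p3 : 0 ≤ max |A| |B| := (abs_nonneg A).trans (le_max_left _ _)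
    nlinarith
  rcases hnear τ hlt with ⟨k, hk⟩ | ⟨k, hk⟩
  · left
    refine ⟨k, hk.trans_le (min_le_left _ _), ?_⟩
    have := h₁ (τ - k - s) (hk.trans_le ((min_le_right _ _).trans (min_le_left _ _)))
    have e : g (s + (τ - k - s)) = g τ := by
      rw [← h.apply_add_int _ k]
      congr 1
      ring
    rwa [e] at this
  · right
    refine ⟨k, hk.trans_le (min_le_left _ _), ?_⟩
    have := h₂ (τ - k - t) (hk.trans_le ((min_le_right _ _).trans (min_le_right _ _)))
    have e : g (t + (τ - k - t)) = g τ := by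
      rw [← h.apply_add_int _ k]
      congr 1
      ring
    rwa [e, ← h.eq] at this

lemma along_point (h : IsDoublePoint g s t) (x y : ℝ) :
    along (deriv g s) (deriv g t) (g s + (x * deriv g s + y * deriv g t) - g s) = x := by
  rw [add_sub_cancel_left, along_add, along_ofReal_mul, along_ofReal_mul, along_self h.indep,
    along_other]
  ring

lemma along_point' (h : IsDoublePoint g s t) (x y : ℝ) :
    along (deriv g t) (deriv g s) (g s + (x * deriv g s + y * deriv g t) - g s) = y := by
  rw [add_sub_cancel_left, along_add, along_ofReal_mul, along_ofReal_mul,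
    along_self h.symm.indep, along_other]
  ring

/-- The curve avoids a truncated cone in each corner. -/
lemma cone_avoids (h : IsDoublePoint g s t) {κ : ℝ} (hκ : 0 < κ) (hκ1 : κ ≤ 1) :
    ∃ η > 0, ∀ x y : ℝ, 0 < |x| → |x| < η → |y| < η → κ * |x| ≤ |y| → κ * |y| ≤ |x| →
      g s + (x * deriv g s + y * deriv g t) ∉ range g := by
  -- With error `κ / 3 ≤ 1 / 3`, the main coordinate on a strand is at least `2|c| / 3` and the
  -- other at most `κ|c| / 3`. Their ratio is at most `κ / 2`, so a point of the strand can lie in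
  -- the cone only for `c = 0`.
  obtain ⟨η, hη, hnear⟩ := h.near_tangents (κ := κ / 3) (by positivity) one_pos
  refine ⟨η, hη, fun x y hx hxη hyη hxy hyx => ?_⟩
  rintro ⟨τ, hτ⟩
  have hA := h.along_point x y
  have hB := h.along_point' x y
  rw [← hτ] at hA hB
  rcases hnear τ (by rwa [hA]) (by rwa [hB]) with ⟨k, -, h1, h2⟩ | ⟨k, -, h1, h2⟩
  · rw [hA] at h1
    rw [hB] at h2
    set c := τ - k - s
    have := abs_sub_abs_le_abs_sub c x
    rw [abs_sub_comm c x] at this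
    have h3 : 2 / 3 * |c| ≤ |x| := by
      linarith [mul_le_mul_of_nonneg_right hκ1 (abs_nonneg c)]
    have h4 : |c| ≤ 0 := by
      by_contra! h5
      nlinarith [mul_le_mul_of_nonneg_left h3 hκ.le, mul_pos hκ h5]
    have h5 : |c| = 0 := le_antisymm h4 (abs_nonneg c)
    rw [h5] at h1 h2
    linarith [abs_sub_abs_le_abs_sub x c]
  · rw [hA] at h2
    rw [hB] at h1
    set c := τ - k - t
    have := abs_sub_abs_le_abs_sub c y
    rw [abs_sub_comm c y] at this
    have h3 : 2 / 3 * |c| ≤ |y| := by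
      linarith [mul_le_mul_of_nonneg_right hκ1 (abs_nonneg c)]
    have h4 : |c| ≤ 0 := by
      by_contra! h5
      nlinarith [mul_le_mul_of_nonneg_left h3 hκ.le, mul_pos hκ h5]
    have h5 : |c| = 0 := le_antisymm h4 (abs_nonneg c)
    rw [h5] at h1 h2
    linarith [abs_sub_abs_le_abs_sub x c]

/-- A short segment across the ray `ε` of the strand at `s` meets the curve exactly once. -/
lemma transversal_segment (h : IsDoublePoint g s t) (ε : ℤˣ) {r : ℝ} (hr : 0 < r) :
    ∀ᶠ x : ℝ in 𝓝[>] (0 : ℝ), ∃ c : ℝ, 0 < c ∧ c < r ∧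
      (∃ l : ℝ, |l| < 1 ∧
        g (s + ((ε : ℤ) : ℝ) * c) = g s + x * (((ε : ℤ) : ℂ) * deriv g s + l * deriv g t)) ∧
      (∀ τ, ∀ l : ℝ, |l| ≤ 1 →
        g τ = g s + x * (((ε : ℤ) : ℂ) * deriv g s + l * deriv g t) →
        ∃ k : ℤ, τ = s + (ε : ℤ) * c + k) ∧
      (∀ᶠ τ in 𝓝[>] (s + (ε : ℤ) * c),
        ((ε : ℤ) : ℝ) * x < along (deriv g s) (deriv g t) (g τ - g s)) ∧
      ∀ᶠ τ in 𝓝[<] (s + (ε : ℤ) * c),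
        along (deriv g s) (deriv g t) (g τ - g s) < ((ε : ℤ) : ℝ) * x := by
  set f : ℝ → ℝ := fun τ => along (deriv g s) (deriv g t) (g τ - g s) with hf
  have hfd : ∀ τ, HasDerivAt f (along (deriv g s) (deriv g t) (deriv g τ)) τ := fun τ =>
    (h.hasDerivAt τ).along (g s)
  have hfc : Continuous f := continuous_iff_continuousAt.2 fun τ => (hfd τ).continuousAt
  have hdc : Continuous fun τ => along (deriv g s) (deriv g t) (deriv g τ) := by
    have := h.smooth.continuous_deriv le_rfl
    unfold along cross
    fun_prop
  have hpos : ∀ᶠ τ in 𝓝 s, 0 < along (deriv g s) (deriv g t) (deriv g τ) :=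
    hdc.continuousAt.eventually_const_lt (by simp only [along_self h.indep]; exact one_pos)
  obtain ⟨r₁, hr₁, hball⟩ := Metric.eventually_nhds_iff.1 hpos
  -- The coordinate along the strand has derivative `1` at `s`, so it takes each value at most once
  -- nearby.
  have hmono : StrictMonoOn f (Ioo (s - r₁) (s + r₁)) :=
    strictMonoOn_of_deriv_pos (convex_Ioo _ _) hfc.continuousOn fun τ hτ => by
      rw [interior_Ioo] at hτ
      rw [(hfd τ).deriv]
      exact hball (by rw [Real.dist_eq, abs_lt]; constructor <;> linarith [hτ.1, hτ.2])
  obtain ⟨r₂, hr₂, hstr⟩ := h.strand (κ := 1 / 3) (by norm_num)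
  obtain ⟨η, hη, hnear⟩ := h.near_tangents (κ := 1 / 3) (by norm_num) hr₁
  have hfs : f s = 0 := by simp [hf, along, cross]
  filter_upwards [Ioo_mem_nhdsGT (show 0 < min (min r r₁) (min r₂ η) / 3 by positivity)] with x hx
  obtain ⟨hx0, hx1⟩ := hx
  rw [lt_div_iff₀ (by norm_num), lt_min_iff, lt_min_iff, lt_min_iff] at hx1
  obtain ⟨⟨hxr, hxr₁⟩, hxr₂, hxη⟩ := hx1
  have hε : ((ε : ℤ) : ℝ) = 1 ∨ ((ε : ℤ) : ℝ) = -1 := by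
    rcases Int.units_eq_one_or ε with rfl | rfl <;> simp
  -- Intermediate value theorem: at parameter distance `2x` the coordinate along the ray is at least
  -- `2x - 2x / 3`, which exceeds `x`.
  obtain ⟨c, hc, hfc0⟩ : ∃ c ∈ Icc 0 (2 * x), f (s + (ε : ℤ) * c) = (ε : ℤ) * x := by
    have hend := (hstr ((ε : ℤ) * (2 * x)) (by
      rcases hε with e | e <;> rw [e, abs_lt] <;> constructor <;> linarith)).1
    change |f _ - _| ≤ _ at hend
    have hcont : ContinuousOn (fun c => (ε : ℤ) * f (s + (ε : ℤ) * c)) (Icc 0 (2 * x)) := by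
      fun_prop
    have := intermediate_value_Icc (by linarith : (0 : ℝ) ≤ 2 * x) hcont
    have hxmem : x ∈ (fun c => (ε : ℤ) * f (s + (ε : ℤ) * c)) '' Icc 0 (2 * x) := by
      apply this
      simp only [mul_zero, add_zero, hfs]
      refine ⟨hx0.le, ?_⟩
      rcases hε with e | e
      · rw [e, abs_of_pos (by linarith : (0 : ℝ) < 1 * (2 * x)), abs_le] at hend
        rw [e]
        linarith
      · rw [e, abs_of_neg (by linarith : (-1 : ℝ) * (2 * x) < 0), abs_le] at hend
        rw [e]
        linarith
    obtain ⟨c, hc, hcx⟩ := hxmem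
    refine ⟨c, hc, ?_⟩
    rw [← hcx]
    rcases hε with e | e <;> rw [e] <;> ring
  have hcpos : 0 < c := by
    rcases hc.1.eq_or_lt with h0 | h0
    · rw [← h0, mul_zero, add_zero, hfs] at hfc0
      rcases hε with e | e <;> rw [e] at hfc0 <;> linarith
    · exact h0
  have habs : |((ε : ℤ) : ℝ) * c| = c := by
    rcases hε with e | e <;> rw [e] <;> simp [abs_of_pos hcpos]
  have hmem : ∀ c', |c'| < r₁ → s + c' ∈ Ioo (s - r₁) (s + r₁) := fun c' h' => by
    rw [abs_lt] at h'
    constructor <;> linarith [h'.1, h'.2]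
  have hcr₁ : |((ε : ℤ) : ℝ) * c| < r₁ := by rw [habs]; linarith [hc.2]
  have hclose := hstr ((ε : ℤ) * c) (by rw [habs]; linarith [hc.2])
  rw [habs] at hclose
  -- With this bound the transverse coordinate is at most `c / 3 ≤ x / 2`, whence `|l| < 1`.
  have hc2 : c ≤ 3 / 2 * x := by
    have := hclose.1
    change |f _ - _| ≤ _ at this
    rw [hfc0, abs_le] at this
    rcases hε with e | e <;> rw [e] at this <;> linarith
  have hI : Ioo (s - r₁) (s + r₁) ∈ 𝓝 (s + (ε : ℤ) * c) := isOpen_Ioo.mem_nhds (hmem _ hcr₁)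
  refine ⟨c, hcpos, by linarith [hc.2], ⟨along (deriv g t) (deriv g s) (g (s + (ε : ℤ) * c) - g s)
    / x, ?_, ?_⟩, ?_, ?_, ?_⟩
  · rw [abs_div, abs_of_pos hx0, div_lt_one hx0]
    linarith [hclose.2]
  · have e := eq_along h.indep (g (s + (ε : ℤ) * c) - g s)
    change _ = (f _ : ℂ) * _ + _ at e
    rw [hfc0] at e
    generalize along (deriv g t) (deriv g s) (g (s + (ε : ℤ) * c) - g s) = y at e ⊢
    rw [sub_eq_iff_eq_add.1 e]
    have hx0' : (x : ℂ) ≠ 0 := ofReal_ne_zero.2 hx0.ne'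
    push_cast
    field_simp
    ring
  · intro τ l hl hτ
    have e : g τ = g s + (((((ε : ℤ) : ℝ) * x : ℝ) : ℂ) * deriv g s +
        ((x * l : ℝ) : ℂ) * deriv g t) := by
      rw [hτ]
      push_cast
      ring
    have hA := h.along_point ((ε : ℤ) * x) (x * l)
    have hB := h.along_point' ((ε : ℤ) * x) (x * l)
    rw [← e] at hA hB
    have hxabs : |((ε : ℤ) : ℝ) * x| = x := by
      rcases hε with e | e <;> rw [e] <;> simp [abs_of_pos hx0]
    have hlabs : |x * l| ≤ x := by
      rw [abs_mul, abs_of_pos hx0]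
      nlinarith
    rcases hnear τ (by rw [hA, hxabs]; linarith) (by rw [hB]; linarith) with
      ⟨k, hk, h1, h2⟩ | ⟨k, hk, h1, h2⟩
    · refine ⟨k, ?_⟩
      have hfτ : f (s + (τ - k - s)) = (ε : ℤ) * x := by
        rw [← hA]
        simp only [hf]
        congr 2
        rw [← h.apply_add_int _ k]
        congr 1
        ring
      have := hmono.injOn (hmem _ hk) (hmem _ hcr₁) (hfτ.trans hfc0.symm)
      linarith
    -- The strand at `t` cannot meet the segment: `|c'| ≤ 3x / 2` makes its coordinate along the
    -- first tangent at most `x / 2` in absolute value, but this coordinate should be `±x`.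
    · exfalso
      rw [hB] at h1
      rw [hA, hxabs] at h2
      set c' := τ - k - t
      have := abs_sub_abs_le_abs_sub c' (x * l)
      rw [abs_sub_comm c' (x * l)] at this
      linarith
  · filter_upwards [self_mem_nhdsWithin, nhdsWithin_le_nhds hI] with τ h1 h2
    rw [← hfc0]
    exact hmono (hmem _ hcr₁) h2 h1
  · filter_upwards [self_mem_nhdsWithin, nhdsWithin_le_nhds hI] with τ h1 h2
    rw [← hfc0]
    exact hmono h2 (hmem _ hcr₁) h1

end IsDoublePoint

end

/-! ### The jump of the winding number across a strand at a double point. -/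

section

open Set Filter Complex

/-- The excluded equation says that `z` divides the segment from `z₁` to `z₂` in the ratio `x : 1`.
Hence the quotient can leave the slit plane only on that segment. -/
lemma mem_slitPlane_of_forall_ne {z z₁ z₂ : ℂ} (h₂ : z - z₂ ≠ 0)
    (h : ∀ x : ℝ, 0 ≤ x → z - z₁ ≠ -x * (z - z₂)) : (z - z₁) / (z - z₂) ∈ slitPlane := by
  by_contra hcon
  rw [mem_slitPlane_iff, not_or, not_lt, not_not] at hcon
  refine h (-((z - z₁) / (z - z₂)).re) (by linarith [hcon.1]) ?_
  have e : (((z - z₁) / (z - z₂)).re : ℂ) = (z - z₁) / (z - z₂) :=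
    Complex.ext rfl (by rw [ofReal_im, hcon.2])
  rw [ofReal_neg, e, neg_neg, div_mul_cancel₀ _ h₂]

namespace IsDoublePoint

variable {g : ℝ → ℂ} {s t : ℝ}

lemma deriv_right_ne_zero (h : IsDoublePoint g s t) : deriv g t ≠ 0 := fun h0 => by
  have := h.indep
  rw [h0] at this
  simp [cross] at this

/-- The imaginary part of the ratio which governs the jump of the winding number. -/
lemma im_ratio (h : IsDoublePoint g s t) (z : ℂ) (y x l : ℝ) :
    ((z - (g s + x * (y * deriv g s + l * deriv g t))) /
      (z - (g s + x * (y * deriv g s + ((-l : ℝ) : ℂ) * deriv g t)))).im =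
    -2 * x * (along (deriv g s) (deriv g t) (z - g s) - y * x) *
      (l * cross (deriv g s) (deriv g t)) /
      normSq (z - (g s + x * (y * deriv g s + ((-l : ℝ) : ℂ) * deriv g t))) := by
  have e := eq_along h.indep (z - g s)
  generalize along (deriv g s) (deriv g t) (z - g s) = p at e ⊢
  generalize along (deriv g t) (deriv g s) (z - g s) = q at e ⊢
  rw [sub_eq_iff_eq_add.1 e, div_im, ← sub_div]
  congr 1
  simp only [cross, add_re, add_im, sub_re, sub_im, mul_re, mul_im, ofReal_re, ofReal_im]
  ring

/-- The two points are the ends of a short segment across the ray, which the loop meets exactly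
once, at `τ`; there the quotient of `IsLoop.wind_sub_wind` is negative. The sign `θ` is chosen so
that the quotient passes from the upper to the lower half plane. -/
lemma wind_sub_wind_aux (h : IsDoublePoint g s t) {a b : ℝ} (hl : IsLoop g a b)
    (hab : b ≤ a + 1) (ε : ℤˣ) (hin : ∀ᶠ c in 𝓝[>] (0 : ℝ), s + ((ε : ℤ) : ℝ) * c ∈ Ioo a b)
    {θ : ℝ} (hθ : |θ| = 1) (hpos : 0 < θ * cross (deriv g s) (deriv g t)) :
    ∀ᶠ x : ℝ in 𝓝[>] (0 : ℝ),
      wind g a b (g s + x * (((ε : ℤ) : ℂ) * deriv g s + θ * deriv g t)) -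
      wind g a b (g s + x * (((ε : ℤ) : ℂ) * deriv g s + ((-θ : ℝ) : ℂ) * deriv g t)) = 1 := by
  obtain ⟨r, hr, hin⟩ := mem_nhdsGT_iff_exists_Ioo_subset.1 hin
  filter_upwards [h.transversal_segment ε hr, self_mem_nhdsWithin] with x hx hx0
  obtain ⟨c, hc0, hcr, ⟨l, hl1, hlg⟩, huniq, hright, hleft⟩ := hx
  have hx0 : 0 < x := hx0
  have hx0' : (x : ℂ) ≠ 0 := ofReal_ne_zero.2 hx0.ne'
  have hcI : s + ((ε : ℤ) : ℝ) * c ∈ Ioo a b := hin ⟨hc0, hcr⟩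
  set τ := s + ((ε : ℤ) : ℝ) * c with hτ
  have hu := h.deriv_right_ne_zero
  -- The loop covers at most one period and `τ` is interior to it, so only the translate `k = 0`
  -- remains.
  have huniq' : ∀ r ∈ Icc a b, ∀ l : ℝ, |l| ≤ 1 →
      g r = g s + x * (((ε : ℤ) : ℂ) * deriv g s + l * deriv g t) → r = τ := by
    intro r hr l hl hg
    obtain ⟨k, hk⟩ := huniq r l hl hg
    have h1 : (-1 : ℝ) < k := by linarith [hcI.2, hr.1]
    have h2 : (k : ℝ) < 1 := by linarith [hcI.1, hr.2]
    have h1' : -1 < k := by exact_mod_cast h1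
    have h2' : k < 1 := by exact_mod_cast h2
    have : k = 0 := by omega
    rw [hk, this]
    simp
  have hnotin : ∀ l' : ℝ, |l'| = 1 →
      g s + x * (((ε : ℤ) : ℂ) * deriv g s + l' * deriv g t) ∉ g '' Icc a b := by
    rintro l' hl' ⟨r, hr, hg⟩
    have hrt := huniq' r hr l' hl'.le hg
    rw [hrt, hlg] at hg
    have e := mul_left_cancel₀ hx0' (add_left_cancel hg)
    have := ofReal_injective (mul_right_cancel₀ hu (add_left_cancel e))
    rw [this] at hl1
    linarith
  have hθ' : |-θ| = 1 := by rwa [abs_neg]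
  have hn1 := hnotin θ hθ
  have hn2 := hnotin (-θ) hθ'
  have hsq : θ * θ = 1 := by rw [← abs_mul_abs_self, hθ, one_mul]
  have hne : ∀ r ∈ Icc a b, 0 < normSq (g r - (g s + x * (((ε : ℤ) : ℂ) * deriv g s +
      ((-θ : ℝ) : ℂ) * deriv g t))) := fun r hr => normSq_pos.2 (IsLoop.sub_ne_zero hn2 hr)
  have him : ∀ r, ((g r - (g s + x * (((ε : ℤ) : ℂ) * deriv g s + θ * deriv g t))) /
      (g r - (g s + x * (((ε : ℤ) : ℂ) * deriv g s + ((-θ : ℝ) : ℂ) * deriv g t)))).im = _ :=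
    fun r => by
      have := h.im_ratio (g r) ((ε : ℤ) : ℝ) x θ
      simpa only [ofReal_intCast] using this
  have hI : Icc a b ∈ 𝓝 τ := Icc_mem_nhds hcI.1 hcI.2
  have hratio : (g τ - (g s + x * (((ε : ℤ) : ℂ) * deriv g s + θ * deriv g t))) /
      (g τ - (g s + x * (((ε : ℤ) : ℂ) * deriv g s + ((-θ : ℝ) : ℂ) * deriv g t))) =
      (((l - θ) / (l + θ) : ℝ) : ℂ) := by
    have e1 : g τ - (g s + x * (((ε : ℤ) : ℂ) * deriv g s + θ * deriv g t)) =
        (x * deriv g t) * ((l - θ : ℝ) : ℂ) := by rw [hlg]; push_cast; ring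
    have e2 : g τ - (g s + x * (((ε : ℤ) : ℂ) * deriv g s + ((-θ : ℝ) : ℂ) * deriv g t)) =
        (x * deriv g t) * ((l + θ : ℝ) : ℂ) := by rw [hlg]; push_cast; ring
    rw [e1, e2, mul_div_mul_left _ _ (mul_ne_zero hx0' hu), ofReal_div]
  refine hl.wind_sub_wind hn1 hn2 hcI ?_ ?_ ?_ ?_ ?_
  · intro r hr hrτ
    refine mem_slitPlane_of_forall_ne (IsLoop.sub_ne_zero hn2 hr) fun y hy he => hrτ ?_
    have hy1 : (1 : ℝ) + y ≠ 0 := by positivity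
    have hy1' : (1 : ℂ) + y ≠ 0 := by exact_mod_cast hy1
    -- The transverse coordinate `l` solving `l - θ = -y (l + θ)`.
    refine huniq' r hr (θ * (1 - y) / (1 + y)) ?_ ?_
    · rw [abs_div, abs_mul, hθ, one_mul, abs_of_pos (by positivity : 0 < 1 + y),
        div_le_one (by positivity), abs_le]
      constructor <;> linarith
    · push_cast at he ⊢
      field_simp
      linear_combination he
  · rw [hratio, ofReal_re]
    have h1 := abs_lt.1 hl1
    have : (l - θ) * (l + θ) < 0 := by nlinarith
    have h0 : l + θ ≠ 0 := fun h0 => by rw [h0] at this; simp at this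
    rw [show (l - θ) / (l + θ) = (l - θ) * (l + θ) / (l + θ) ^ 2 by field_simp]
    exact div_neg_of_neg_of_pos this (by positivity)
  · rw [hratio, ofReal_im]
  · filter_upwards [hleft, nhdsWithin_le_nhds hI] with r hr hrI
    rw [him]
    refine div_pos ?_ (hne r hrI)
    exact mul_pos (by nlinarith) hpos
  · filter_upwards [hright, nhdsWithin_le_nhds hI] with r hr hrI
    rw [him]
    refine div_neg_of_neg_of_pos ?_ (hne r hrI)
    exact mul_neg_of_neg_of_pos (by nlinarith) hpos

/-- The orientation sign of a double point. -/
noncomputable def sign (g : ℝ → ℂ) (s t : ℝ) : ℤˣ :=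
  if 0 < cross (deriv g s) (deriv g t) then 1 else -1

/-- Across a ray in the loop the winding number jumps by the sign of the double point. -/
lemma wind_sub_wind (h : IsDoublePoint g s t) {a b : ℝ} (hl : IsLoop g a b)
    (hab : b ≤ a + 1) (ε : ℤˣ) (hin : ∀ᶠ c in 𝓝[>] (0 : ℝ), s + ((ε : ℤ) : ℝ) * c ∈ Ioo a b) :
    ∀ᶠ x : ℝ in 𝓝[>] (0 : ℝ), wind g a b (cornerPoint g s t ε 1 x) -
      wind g a b (cornerPoint g s t ε (-1) x) = sign g s t := by
  by_cases hc : 0 < cross (deriv g s) (deriv g t)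
  · filter_upwards [h.wind_sub_wind_aux hl hab ε hin (θ := 1) (by simp) (by simpa)] with x hx
    simpa [cornerPoint, sign, hc] using hx
  · have hc' : cross (deriv g s) (deriv g t) < 0 := lt_of_le_of_ne (not_lt.1 hc) h.indep
    filter_upwards [h.wind_sub_wind_aux hl hab ε hin (θ := -1) (by simp) (by linarith)] with x hx
    have : wind g a b (cornerPoint g s t ε (-1) x) -
      wind g a b (cornerPoint g s t ε 1 x) = 1 := by simpa [cornerPoint] using hx
    simp only [sign, hc, if_false, Units.val_neg, Units.val_one]
    omega

/-- Near a ray outside the loop the winding number is constant. -/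
lemma wind_eq_wind (h : IsDoublePoint g s t) {a b : ℝ} (hl : IsLoop g a b) (ε : ℤˣ)
    (hout : ∀ᶠ c in 𝓝[>] (0 : ℝ), ∀ k : ℤ, s + ((ε : ℤ) : ℝ) * c + k ∉ Icc a b)
    {r : ℝ} (hr : 0 < r) :
    ∀ᶠ x : ℝ in 𝓝[>] (0 : ℝ), ∃ c, 0 < c ∧ c < r ∧ ∀ δ,
      wind g a b (cornerPoint g s t ε δ x) = wind g a b (g (s + ((ε : ℤ) : ℝ) * c)) := by
  obtain ⟨r', hr', hout⟩ := mem_nhdsGT_iff_exists_Ioo_subset.1 hout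
  have hr' : 0 < r' := hr'
  filter_upwards [h.transversal_segment ε (lt_min hr hr')] with x hx
  obtain ⟨c, hc0, hcr, ⟨l, hl1, hlg⟩, huniq, -, -⟩ := hx
  rw [lt_min_iff] at hcr
  have hc := hout ⟨hc0, hcr.2⟩
  refine ⟨c, hc0, hcr.1, fun δ => ?_⟩
  -- The segment `q` contains both corner points and one point of the curve. It meets the curve only
  -- at the translates of a single parameter, all of them outside the loop, so the winding number is
  -- constant on it.
  set q : ℝ → ℂ := fun l => g s + x * (((ε : ℤ) : ℂ) * deriv g s + l * deriv g t) with hq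
  have hpre : IsPreconnected (q '' Icc (-1) 1) :=
    isPreconnected_Icc.image _ (by fun_prop)
  have hmem1 : cornerPoint g s t ε δ x ∈ q '' Icc (-1) 1 := by
    refine ⟨((δ : ℤ) : ℝ), ?_, by simp [hq, cornerPoint]⟩
    rcases Int.units_eq_one_or δ with rfl | rfl <;> simp
  have hmem2 : g (s + ((ε : ℤ) : ℝ) * c) ∈ q '' Icc (-1) 1 :=
    ⟨l, abs_le.1 hl1.le, hlg.symm⟩
  refine hl.wind_eq_of_isPreconnected hpre ?_ hmem1 hmem2
  rintro _ ⟨l', hl', rfl⟩ ⟨τ, hτ, hgτ⟩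
  obtain ⟨k, rfl⟩ := huniq τ l' (abs_le.2 hl') hgτ
  exact hc k hτ

lemma wind_eq_wind_neg (h : IsDoublePoint g s t) {a b : ℝ} (hl : IsLoop g a b) (ε : ℤˣ)
    (hout : ∀ᶠ c in 𝓝[>] (0 : ℝ), ∀ k : ℤ, s + ((ε : ℤ) : ℝ) * c + k ∉ Icc a b) :
    ∀ᶠ x : ℝ in 𝓝[>] (0 : ℝ), wind g a b (cornerPoint g s t ε 1 x) =
      wind g a b (cornerPoint g s t ε (-1) x) := by
  filter_upwards [h.wind_eq_wind hl ε hout one_pos] with x hx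
  obtain ⟨c, -, -, hc⟩ := hx
  rw [hc, hc]

end IsDoublePoint

end

/-! ### Planar charts, winding numbers of regions, and regions at corners. -/

section

open Set Filter Complex

namespace KnotDiagram

variable {E : Type} [NormedAddCommGroup E] [NormedSpace ℝ E] {S : OrientedSurface E}

/-- The curve of a knot diagram as a periodic function on the line. -/
def line (D : KnotDiagram S) (t : ℝ) : E := D.curve (t : UnitAddCircle)

lemma hasDerivAt_line (D : KnotDiagram S) (t : ℝ) :
    HasDerivAt D.line (D.velocity (t : UnitAddCircle)) t := by
  have h : HasDerivAt D.line (deriv D.line t) t :=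
    (D.smooth.differentiable (by simp) t).hasDerivAt
  have e : D.velocity (t : UnitAddCircle) = deriv D.line t := by
    have : (fun x : ℝ => D.curve ((t : UnitAddCircle) + (x : UnitAddCircle))) =
        fun x => D.line (t + x) := by
      funext x
      rw [line, AddCircle.coe_add]
    rw [velocity, this, deriv_comp_const_add, add_zero]
  rwa [e]

lemma mem_region_iff {D : KnotDiagram S} {R : Set E}
    (hR : ∃ y ∈ S.carrier \ range D.curve, R = connectedComponentIn (S.carrier \ range D.curve) y)
    {y : E} (hy : y ∈ R) : R = connectedComponentIn (S.carrier \ range D.curve) y := by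
  obtain ⟨y₀, -, rfl⟩ := hR
  exact connectedComponentIn_eq hy

lemma Region.subset {D : KnotDiagram S} (R : D.Region) : R.1 ⊆ S.carrier \ range D.curve := by
  obtain ⟨y, -, h⟩ := R.2
  rw [h]
  exact connectedComponentIn_subset _ _

lemma Region.nonempty {D : KnotDiagram S} (R : D.Region) : R.1.Nonempty := by
  obtain ⟨y, hy, h⟩ := R.2
  rw [h]
  exact ⟨y, mem_connectedComponentIn hy⟩

lemma Region.isPreconnected {D : KnotDiagram S} (R : D.Region) : IsPreconnected R.1 := by
  obtain ⟨y, -, h⟩ := R.2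
  rw [h]
  exact isPreconnected_connectedComponentIn

lemma Region.eq_of_mem {D : KnotDiagram S} {R R' : D.Region} {y : E} (h : y ∈ R.1)
    (h' : y ∈ R'.1) : R = R' :=
  Subtype.ext ((mem_region_iff R.2 h).trans (mem_region_iff R'.2 h').symm)

/-- A preconnected set off the curve which meets a region lies in this region. -/
lemma Region.subset_of_isPreconnected {D : KnotDiagram S} (R : D.Region) {s : Set E}
    (hs : IsPreconnected s) (hsub : s ⊆ S.carrier \ range D.curve) {y : E} (hy : y ∈ s)
    (hyR : y ∈ R.1) : s ⊆ R.1 := by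
  rw [mem_region_iff R.2 hyR]
  exact hs.subset_connectedComponentIn hy hsub

/-- A smooth chart of the surface onto the plane, defined off the set `pole`, which contains the
curve of `D`. -/
structure PlanarChart (D : KnotDiagram S) where
  toPlane : E → ℂ
  ofPlane : ℂ → E
  pole : Set E
  isClosed_pole : IsClosed pole
  ofPlane_mem : ∀ z, ofPlane z ∈ S.carrier \ pole
  left_inv : ∀ z, toPlane (ofPlane z) = z
  right_inv : ∀ y ∈ S.carrier \ pole, ofPlane (toPlane y) = y
  differentiable_ofPlane : Differentiable ℝ ofPlane
  continuousAt_toPlane : ∀ y ∈ S.carrier \ pole, ContinuousAt toPlane y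
  differentiableAt_toPlane : ∀ s, DifferentiableAt ℝ toPlane (D.curve s)
  curve_notMem_pole : ∀ s, D.curve s ∉ pole
  smooth : ContDiff ℝ 1 fun t : ℝ => toPlane (D.line t)

namespace PlanarChart

variable {D : KnotDiagram S} (C : PlanarChart D)

/-- The curve of the diagram in the chart. -/
def path (t : ℝ) : ℂ := C.toPlane (D.line t)

lemma curve_mem (s : UnitAddCircle) : D.curve s ∈ S.carrier \ C.pole :=
  ⟨D.mem_carrier s, C.curve_notMem_pole s⟩

lemma ofPlane_path (t : ℝ) : C.ofPlane (C.path t) = D.line t := C.right_inv _ (C.curve_mem _)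

lemma path_eq_iff {s t : ℝ} : C.path s = C.path t ↔ D.line s = D.line t :=
  ⟨fun h => by rw [← C.ofPlane_path, h, C.ofPlane_path], fun h => by rw [path, h, path]⟩

lemma ofPlane_notMem_range {z : ℂ} (hz : z ∉ range C.path) : C.ofPlane z ∉ range D.curve := by
  rintro ⟨s, hs⟩
  obtain ⟨t, rfl⟩ := QuotientAddGroup.mk_surjective s
  exact hz ⟨t, by rw [path, ← C.left_inv z, ← hs]; rfl⟩

lemma toPlane_notMem_range {y : E} (hy : y ∈ S.carrier \ C.pole) (h : y ∉ range D.curve) :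
    C.toPlane y ∉ range C.path := by
  rintro ⟨t, ht⟩
  refine h ⟨(t : UnitAddCircle), ?_⟩
  rw [← C.right_inv y hy, ← ht, C.ofPlane_path]
  rfl

lemma hasDerivAt_path (t : ℝ) : HasDerivAt C.path (deriv C.path t) t :=
  (C.smooth.differentiable one_ne_zero t).hasDerivAt

lemma deriv_path (t : ℝ) :
    deriv C.path t = fderiv ℝ C.toPlane (D.line t) (D.velocity (t : UnitAddCircle)) :=
  ((C.differentiableAt_toPlane t).hasFDerivAt.comp_hasDerivAt t (D.hasDerivAt_line t)).deriv

lemma velocity_eq (t : ℝ) :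
    D.velocity (t : UnitAddCircle) = fderiv ℝ C.ofPlane (C.path t) (deriv C.path t) := by
  have h := ((C.differentiable_ofPlane (C.path t)).hasFDerivAt.comp_hasDerivAt t
    (C.hasDerivAt_path t))
  have e : C.ofPlane ∘ C.path = D.line := funext C.ofPlane_path
  rw [e] at h
  exact (D.hasDerivAt_line t).unique h

lemma isLoop {a b : ℝ} (h : a < b) (hc : D.line a = D.line b) : IsLoop C.path a b :=
  ⟨C.smooth, h, C.path_eq_iff.2 hc⟩

lemma coe_eq_coe_iff {s t : ℝ} :
    (s : UnitAddCircle) = (t : UnitAddCircle) ↔ ∃ k : ℤ, s = t + k := by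
  rw [← sub_eq_zero, ← AddCircle.coe_sub, AddCircle.coe_eq_zero_iff]
  simp only [zsmul_eq_mul, mul_one]
  exact exists_congr fun k => ⟨fun h => by linarith, fun h => by linarith⟩

lemma isDoublePoint {s t : ℝ} (hne : (s : UnitAddCircle) ≠ (t : UnitAddCircle))
    (h : D.line s = D.line t) : IsDoublePoint C.path s t where
  smooth := C.smooth
  periodic x := by simp [path, line]
  eq := C.path_eq_iff.2 h
  only r hr := by
    rw [C.path_eq_iff] at hr
    rcases D.no_triple r s t hr h with e | e | e
    · exact Or.inl (coe_eq_coe_iff.1 e)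
    · exact absurd e hne
    · exact Or.inr (coe_eq_coe_iff.1 e)
  indep := by
    intro h0
    have hli := D.transverse s t hne h
    change LinearIndependent ℝ ![D.velocity s, D.velocity t] at hli
    rw [LinearIndependent.pair_iff] at hli
    have key : ∀ p q : ℝ, p * deriv C.path s + q * deriv C.path t = 0 → p = 0 ∧ q = 0 := by
      intro p q hpq
      apply hli p q
      rw [C.velocity_eq, C.velocity_eq, ← C.path_eq_iff.2 h, ← map_smul, ← map_smul, ← map_add]
      rw [real_smul, real_smul, hpq, map_zero]
    simp only [cross] at h0
    -- If `cross` vanishes, real parts and imaginary parts each give a linear relation between the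
    -- two velocities. Independence then forces the velocity at `s` to be zero, which is itself a
    -- relation.
    have h1 := key (deriv C.path t).re (-(deriv C.path s).re) (by
      apply Complex.ext
      · simp
        ring
      · simp
        linarith)
    have h2 := key (deriv C.path t).im (-(deriv C.path s).im) (by
      apply Complex.ext
      · simp
        linarith
      · simp
        ring)
    have h3 := key 1 0 (by
      apply Complex.ext <;> simp
      · linarith [h1.2]
      · linarith [h2.2])
    exact one_ne_zero h3.1

open Classical in
/-- The winding number of the loop on `[a, b]` about a point of the surface. -/
noncomputable def windAt (a b : ℝ) (y : E) : ℤ :=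
  if y ∈ C.pole then 0 else wind C.path a b (C.toPlane y)

/-- The winding number of the loop on `[a, b]` about a region. -/
noncomputable def regionWind (a b : ℝ) (R : D.Region) : ℤ := C.windAt a b R.nonempty.choose

/-- At the pole the value `0` is the right one: off the compact image of a large closed disc the
winding number is zero. Elsewhere the chart transports the local constancy in the plane. -/
lemma windAt_eventually_eq {a b : ℝ} (hl : IsLoop C.path a b) {y : E}
    (hy : y ∈ S.carrier \ range D.curve) :
    ∀ᶠ y' in 𝓝[S.carrier \ range D.curve] y, C.windAt a b y' = C.windAt a b y := by
  by_cases hp : y ∈ C.pole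
  · obtain ⟨s, hs, hsub⟩ := (Metric.hasBasis_cobounded_compl_closedBall (0 : ℂ)).eventually_iff.1
      hl.wind_eventually_zero
    have hK : IsCompact (C.ofPlane '' Metric.closedBall 0 s) :=
      (isCompact_closedBall 0 s).image C.differentiable_ofPlane.continuous
    have hyK : y ∉ C.ofPlane '' Metric.closedBall 0 s := by
      rintro ⟨z, -, rfl⟩
      exact (C.ofPlane_mem z).2 hp
    filter_upwards [self_mem_nhdsWithin, nhdsWithin_le_nhds (hK.isClosed.isOpen_compl.mem_nhds hyK)]
      with y' hy' hy'K
    rw [windAt, windAt, if_pos hp]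
    split_ifs with hp'
    · rfl
    · refine hsub fun hb => hy'K ⟨_, hb, C.right_inv y' ⟨hy'.1, hp'⟩⟩
  · have hn := C.toPlane_notMem_range ⟨hy.1, hp⟩ hy.2
    have h1 := (C.continuousAt_toPlane y ⟨hy.1, hp⟩).eventually
      (hl.wind_eventually_eq fun h => hn (image_subset_range _ _ h))
    filter_upwards [nhdsWithin_le_nhds h1,
      nhdsWithin_le_nhds (C.isClosed_pole.isOpen_compl.mem_nhds hp)] with y' hy' hp'
    rw [windAt, windAt, if_neg hp, if_neg hp', hy']

lemma regionWind_eq {a b : ℝ} (hl : IsLoop C.path a b) {R : D.Region} {y : E} (hy : y ∈ R.1) :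
    C.regionWind a b R = C.windAt a b y := by
  refine R.isPreconnected.constant (f := C.windAt a b) (fun x hx => ?_) R.nonempty.choose_spec hy
  rw [ContinuousWithinAt, nhds_discrete ℤ, tendsto_pure]
  exact nhdsWithin_mono _ R.subset (C.windAt_eventually_eq hl (R.subset hx))

/-- The region `R` contains the points near the double point `(s, t)` in the corner `(ε, δ)`. -/
def IsCorner (R : D.Region) (s t : ℝ) (ε δ : ℤˣ) : Prop :=
  ∀ᶠ h : ℝ in 𝓝[>] (0 : ℝ), C.ofPlane (cornerPoint C.path s t ε δ h) ∈ R.1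

variable {C}

lemma IsCorner.eventually_wind {R : D.Region} {s t a b : ℝ} {ε δ : ℤˣ} (h : C.IsCorner R s t ε δ)
    (hl : IsLoop C.path a b) :
    ∀ᶠ x : ℝ in 𝓝[>] (0 : ℝ), wind C.path a b (cornerPoint C.path s t ε δ x) =
      C.regionWind a b R := by
  filter_upwards [h] with x hx
  rw [C.regionWind_eq hl hx, windAt, if_neg (C.ofPlane_mem _).2, C.left_inv]

lemma IsCorner.unique {R R' : D.Region} {s t : ℝ} {ε δ : ℤˣ} (h : C.IsCorner R s t ε δ)
    (h' : C.IsCorner R' s t ε δ) : R = R' := by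
  obtain ⟨x, hx, hx'⟩ := (h.and h').exists
  exact Region.eq_of_mem hx hx'

lemma IsCorner.symm {R : D.Region} {s t : ℝ} {ε δ : ℤˣ} (hd : IsDoublePoint C.path s t)
    (h : C.IsCorner R s t ε δ) : C.IsCorner R t s δ ε := by
  unfold IsCorner
  rwa [hd.cornerPoint_symm]

/-- A truncated cone in the corner `(ε, δ)`. -/
def cone (g : ℝ → ℂ) (s t : ℝ) (ε δ : ℤˣ) (κ η : ℝ) : Set ℂ :=
  (fun q : ℝ × ℝ => g s + (((((ε : ℤ) : ℝ) * q.1 : ℝ) : ℂ) * deriv g s +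
    ((((δ : ℤ) : ℝ) * q.2 : ℝ) : ℂ) * deriv g t)) ''
    ((Ioo 0 η ×ˢ Ioo 0 η) ∩ ({q | κ * q.1 - q.2 ≤ 0} ∩ {q | κ * q.2 - q.1 ≤ 0}))

lemma isPreconnected_cone (g : ℝ → ℂ) (s t : ℝ) (ε δ : ℤˣ) (κ η : ℝ) :
    IsPreconnected (cone g s t ε δ κ η) := by
  refine IsPreconnected.image (Convex.isPreconnected ?_) _ (by fun_prop)
  refine ((convex_Ioo 0 η).prod (convex_Ioo 0 η)).inter (Convex.inter ?_ ?_)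
  · exact convex_halfSpace_le (f := fun q : ℝ × ℝ => κ * q.1 - q.2)
      ⟨fun x y => by simp; ring, fun c x => by simp; ring⟩ 0
  · exact convex_halfSpace_le (f := fun q : ℝ × ℝ => κ * q.2 - q.1)
      ⟨fun x y => by simp; ring, fun c x => by simp; ring⟩ 0

lemma cornerPoint_mem_cone (g : ℝ → ℂ) (s t : ℝ) (ε δ : ℤˣ) {κ η x : ℝ} (hκ : κ ≤ 1)
    (hx : 0 < x) (hxη : x < η) : cornerPoint g s t ε δ x ∈ cone g s t ε δ κ η := by
  refine ⟨(x, x), ⟨⟨⟨hx, hxη⟩, ⟨hx, hxη⟩⟩, ?_, ?_⟩, ?_⟩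
  · simp only [mem_ofPred_eq]; nlinarith
  · simp only [mem_ofPred_eq]; nlinarith
  · simp only [cornerPoint]
    push_cast
    ring

lemma exists_cone {s t : ℝ} (hd : IsDoublePoint C.path s t) (ε δ : ℤˣ) {κ : ℝ} (hκ : 0 < κ)
    (hκ1 : κ ≤ 1) : ∃ η > 0, C.ofPlane '' cone C.path s t ε δ κ η ⊆ S.carrier \ range D.curve := by
  obtain ⟨η, hη, h⟩ := hd.cone_avoids hκ hκ1
  have habs : ∀ (u : ℤˣ) (x : ℝ), 0 < x → |((u : ℤ) : ℝ) * x| = x := by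
    intro u x hx
    rcases Int.units_eq_one_or u with rfl | rfl <;> simp [abs_of_pos hx]
  refine ⟨η, hη, ?_⟩
  rintro _ ⟨_, ⟨⟨x, y⟩, ⟨⟨hx, hy⟩, hxy, hyx⟩, rfl⟩, rfl⟩
  simp only [mem_ofPred_eq] at hx hy hxy hyx
  refine ⟨(C.ofPlane_mem _).1, C.ofPlane_notMem_range (h _ _ ?_ ?_ ?_ ?_ ?_)⟩ <;>
    simp only [habs _ _ hx.1, habs _ _ hy.1]
  · exact hx.1
  · exact hx.2
  · exact hy.2
  · linarith
  · linarith

/-- The cone is connected and off the curve, hence lies in a single region, and it contains all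
corner points close to the crossing. -/
lemma isCorner_of_mem_cone {s t : ℝ} {ε δ : ℤˣ} {κ η : ℝ} (hη : 0 < η)
    (hκ1 : κ ≤ 1) (hsub : C.ofPlane '' cone C.path s t ε δ κ η ⊆ S.carrier \ range D.curve)
    {R : D.Region} {z : ℂ} (hz : z ∈ cone C.path s t ε δ κ η) (hzR : C.ofPlane z ∈ R.1) :
    C.IsCorner R s t ε δ := by
  have hpre := (isPreconnected_cone C.path s t ε δ κ η).image C.ofPlane
    C.differentiable_ofPlane.continuous.continuousOn
  have := R.subset_of_isPreconnected hpre hsub (mem_image_of_mem _ hz) hzR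
  filter_upwards [Ioo_mem_nhdsGT hη] with x hx
  exact this (mem_image_of_mem _ (cornerPoint_mem_cone _ _ _ _ _ hκ1 hx.1 hx.2))

lemma exists_isCorner {s t : ℝ} (hd : IsDoublePoint C.path s t) (ε δ : ℤˣ) :
    ∃ R : D.Region, C.IsCorner R s t ε δ := by
  obtain ⟨η, hη, hsub⟩ := exists_cone hd ε δ one_pos le_rfl
  have hz := cornerPoint_mem_cone C.path s t ε δ le_rfl (half_pos hη) (half_lt_self hη)
  exact ⟨⟨_, _, hsub (mem_image_of_mem _ hz), rfl⟩, isCorner_of_mem_cone hη le_rfl hsub hz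
    (mem_connectedComponentIn (hsub (mem_image_of_mem _ hz)))⟩

lemma IsCorner.exists_curve {s t : ℝ} (hd : IsDoublePoint C.path s t) {R : D.Region} {ε δ : ℤˣ}
    (h : C.IsCorner R s t ε δ) :
    ∃ (η : ℝ → E) (a b : ℝ), 0 < a ∧ 0 < b ∧ η 0 = D.line s ∧
      HasDerivWithinAt η (a • ε • D.velocity s + b • δ • D.velocity t) (Ici 0) 0 ∧
      ∀ᶠ x in 𝓝[>] (0 : ℝ), η x ∈ R.1 := by
  refine ⟨fun x => C.ofPlane (cornerPoint C.path s t ε δ x), 1, 1, one_pos, one_pos, ?_, ?_, h⟩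
  · simp [cornerPoint, C.ofPlane_path]
  · have h1 : HasDerivAt (fun x : ℝ => cornerPoint C.path s t ε δ x)
        (((ε : ℤ) : ℂ) * deriv C.path s + ((δ : ℤ) : ℂ) * deriv C.path t) 0 := by
      have := ((hasDerivAt_id (0 : ℝ)).ofReal_comp.mul_const
        (((ε : ℤ) : ℂ) * deriv C.path s + ((δ : ℤ) : ℂ) * deriv C.path t)).const_add (C.path s)
      simpa [cornerPoint] using this
    have h2 : cornerPoint C.path s t ε δ 0 = C.path s := by simp [cornerPoint]
    have h3 := (C.differentiable_ofPlane (cornerPoint C.path s t ε δ 0)).hasFDerivAt.comp_hasDerivAt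
      (0 : ℝ) h1
    rw [h2] at h3
    convert! h3.hasDerivWithinAt using 1
    rw [map_add, C.velocity_eq, C.velocity_eq, ← hd.eq, one_smul, one_smul, Units.smul_def,
      Units.smul_def, ← map_zsmul, ← map_zsmul, zsmul_eq_mul, zsmul_eq_mul]

/-- In the chart, the coordinates of a test curve grow like `a x` and `b x` in the directions of the
two rays, so it enters a sufficiently wide cone. Thus the region touching a given corner does not
depend on the test curve. -/
lemma isCorner_of_curve {s t : ℝ} (hd : IsDoublePoint C.path s t) {R : D.Region} {ε δ : ℤˣ}
    {η : ℝ → E} {a b : ℝ} (ha : 0 < a) (hb : 0 < b) (h0 : η 0 = D.line s)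
    (hη : HasDerivWithinAt η (a • ε • D.velocity s + b • δ • D.velocity t) (Ici 0) 0)
    (hR : ∀ᶠ x in 𝓝[>] (0 : ℝ), η x ∈ R.1) : C.IsCorner R s t ε δ := by
  have hst : D.line s = D.line t := C.path_eq_iff.1 hd.eq
  set ζ : ℝ → ℂ := fun x => C.toPlane (η x) with hζ
  have hζ0 : ζ 0 = C.path s := by simp only [hζ, h0, path]
  have hζd : HasDerivWithinAt ζ (((a * (ε : ℤ) : ℝ) : ℂ) * deriv C.path s +
      ((b * (δ : ℤ) : ℝ) : ℂ) * deriv C.path t) (Ioi 0) 0 := by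
    have h1 : HasFDerivAt C.toPlane (fderiv ℝ C.toPlane (D.line s)) (η 0) := by
      rw [h0]
      exact (C.differentiableAt_toPlane s).hasFDerivAt
    have := h1.comp_hasDerivWithinAt (0 : ℝ) (hη.mono Ioi_subset_Ici_self)
    convert! this using 1
    rw [C.deriv_path, C.deriv_path, ← hst, map_add, map_smul _ a, map_smul _ b,
      Units.smul_def ε, Units.smul_def δ, map_zsmul, map_zsmul]
    simp only [zsmul_eq_mul, real_smul]
    push_cast
    ring
  have hcoord : ∀ (u v : ℂ) (z' : ℂ), HasDerivWithinAt ζ z' (Ioi 0) 0 → ∀ c > 0,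
      ∀ᶠ x in 𝓝[>] (0 : ℝ), |along v u (ζ x - C.path s) - x * along v u z'| ≤ c * x := by
    intro u v z' hz' c hc
    have h := hz'.sub_const (C.path s)
    have hre := (reCLM.hasFDerivAt.comp_hasDerivWithinAt (0 : ℝ) h)
    have him := (imCLM.hasFDerivAt.comp_hasDerivWithinAt (0 : ℝ) h)
    have hal : HasDerivWithinAt (fun x => along v u (ζ x - C.path s)) (along v u z') (Ioi 0) 0 :=
      ((hre.mul_const u.im).sub (him.mul_const u.re)).div_const (cross v u)
    rw [hasDerivWithinAt_iff_isLittleO] at hal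
    filter_upwards [hal.def hc, self_mem_nhdsWithin] with x hx hx0
    rw [hζ0, sub_self, along_zero, sub_zero, sub_zero, Real.norm_eq_abs, Real.norm_eq_abs,
      abs_of_pos (show (0 : ℝ) < x from hx0), smul_eq_mul] at hx
    exact hx
  have e1 := hcoord (deriv C.path t) (deriv C.path s) _ hζd (a / 2) (by positivity)
  have e2 := hcoord (deriv C.path s) (deriv C.path t) _ hζd (b / 2) (by positivity)
  simp only [along_add, along_ofReal_mul, along_self hd.indep, along_self hd.symm.indep,
    along_other, mul_zero, mul_one, add_zero, zero_add] at e1 e2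
  -- The errors `a / 2` and `b / 2` confine the coordinates to `[a x / 2, 3 a x / 2]` and `[b x / 2,
  -- 3 b x / 2]`; this `κ` puts all such pairs between the slopes of the cone.
  set κ := min 1 (min (b / (3 * a)) (a / (3 * b))) with hκ
  have hκ0 : 0 < κ := by positivity
  have hκ1 : κ ≤ 1 := min_le_left _ _
  have hκa : κ * (3 * a) ≤ b := by
    rw [← le_div_iff₀ (by positivity)]
    exact (min_le_right _ _).trans (min_le_left _ _)
  have hκb : κ * (3 * b) ≤ a := by
    rw [← le_div_iff₀ (by positivity)]
    exact (min_le_right _ _).trans (min_le_right _ _)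
  obtain ⟨r, hr, hsub⟩ := exists_cone hd ε δ hκ0 hκ1
  have hpole : ∀ᶠ x in 𝓝[>] (0 : ℝ), η x ∉ C.pole := by
    have h := (hη.mono Ioi_subset_Ici_self).continuousWithinAt.tendsto
    rw [h0] at h
    exact h.eventually (C.isClosed_pole.isOpen_compl.mem_nhds (C.curve_notMem_pole _))
  obtain ⟨x, hxR, hxp, h1, h2, hx0, hxr⟩ := (hR.and (hpole.and (e1.and (e2.and
    (Ioo_mem_nhdsGT (show 0 < r / (2 * (a + b)) by positivity)))))).exists
  rw [lt_div_iff₀ (by positivity)] at hxr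
  have hsplit : ∀ (u : ℤˣ) (c X : ℝ), |X - x * (c * (u : ℤ))| ≤ c / 2 * x →
      ∃ X', X = (u : ℤ) * X' ∧ c / 2 * x ≤ X' ∧ X' ≤ 3 * c / 2 * x := by
    intro u c X h
    rw [abs_le] at h
    refine ⟨(u : ℤ) * X, ?_, ?_⟩ <;> rcases Int.units_eq_one_or u with rfl | rfl
    · simp
    · simp
    · simp at h ⊢
      constructor <;> linarith
    · simp at h ⊢
      constructor <;> linarith
  obtain ⟨X, hX, hX1, hX2⟩ := hsplit ε a _ h1
  obtain ⟨Y, hY, hY1, hY2⟩ := hsplit δ b _ h2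
  have hax : 0 < a * x := mul_pos ha hx0
  have hbx : 0 < b * x := mul_pos hb hx0
  have hmem : ζ x ∈ cone C.path s t ε δ κ r := by
    refine ⟨(X, Y), ⟨⟨⟨by linarith, by linarith⟩, ⟨by linarith, by linarith⟩⟩, ?_, ?_⟩, ?_⟩
    · rw [mem_ofPred_eq]
      nlinarith [mul_le_mul_of_nonneg_right hκa hx0.le, mul_le_mul_of_nonneg_left hX2 hκ0.le]
    · rw [mem_ofPred_eq]
      nlinarith [mul_le_mul_of_nonneg_right hκb hx0.le, mul_le_mul_of_nonneg_left hY2 hκ0.le]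
    · simp only
      rw [← hX, ← hY, ← eq_along hd.indep]
      ring
  refine isCorner_of_mem_cone hr hκ1 hsub hmem ?_
  rwa [C.right_inv _ ⟨(R.subset hxR).1, hxp⟩]

end PlanarChart
end KnotDiagram

end

/-! ### Crossings and their pairs of parameters. -/

section

open Set Filter Complex

/-- A curve parameter close to `s` stays outside all integer translates of `[a, b]` if it stays
outside `[a, b]`. -/
lemma eventually_forall_int_notMem_Icc {a b s : ℝ} (ha : 0 ≤ a) (hb : b < 1) (hs : s ∈ Ico 0 1)
    (ε : ℤˣ) (h : ∀ᶠ c in 𝓝[>] (0 : ℝ), s + ((ε : ℤ) : ℝ) * c ∉ Icc a b) :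
    ∀ᶠ c in 𝓝[>] (0 : ℝ), ∀ k : ℤ, s + ((ε : ℤ) : ℝ) * c + k ∉ Icc a b := by
  filter_upwards [h, Ioo_mem_nhdsGT (show 0 < min (1 - b) (1 - s) from
    lt_min (by linarith) (by linarith [hs.2]))] with c hc hcI k hk
  obtain ⟨hc0, hc1⟩ := hcI
  rw [lt_min_iff] at hc1
  have hε : ((ε : ℤ) : ℝ) = 1 ∨ ((ε : ℤ) : ℝ) = -1 := by
    rcases Int.units_eq_one_or ε with rfl | rfl <;> simp
  rcases lt_trichotomy k 0 with hk0 | rfl | hk0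
  · have : (k : ℝ) ≤ -1 := by exact_mod_cast (by omega : k ≤ -1)
    have := hk.1
    have := hs.2
    rcases hε with e | e <;> rw [e] at hk <;> linarith [hk.1]
  · exact hc (by simpa using hk)
  · have : (1 : ℝ) ≤ k := by exact_mod_cast hk0
    have := hs.1
    rcases hε with e | e <;> rw [e] at hk <;> linarith [hk.2]

lemma eventually_mem_of_mem_nhds {s : ℝ} (ε : ℤˣ) {U : Set ℝ} (hU : U ∈ 𝓝 s) :
    ∀ᶠ c in 𝓝[>] (0 : ℝ), s + ((ε : ℤ) : ℝ) * c ∈ U := by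
  have hc : ContinuousAt (fun c : ℝ => s + ((ε : ℤ) : ℝ) * c) 0 := by fun_prop
  exact nhdsWithin_le_nhds (hc (by simpa using hU))

namespace KnotDiagram

variable {E : Type} [NormedAddCommGroup E] [NormedSpace ℝ E] {S : OrientedSurface E}
  {D : KnotDiagram S}

/-- The representative in `[0, 1)` of a point of the circle. -/
noncomputable def rep (s : UnitAddCircle) : ℝ := AddCircle.equivIco (1 : ℝ) 0 s

lemma rep_mem (s : UnitAddCircle) : rep s ∈ Ico (0 : ℝ) 1 :=
  ⟨(AddCircle.equivIco (1 : ℝ) 0 s).2.1,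
    (AddCircle.equivIco (1 : ℝ) 0 s).2.2.trans_eq (zero_add 1)⟩

lemma coe_rep (s : UnitAddCircle) : (rep s : UnitAddCircle) = s := AddCircle.coe_equivIco

lemma rep_coe {t : ℝ} (ht : t ∈ Ico (0 : ℝ) 1) : rep (t : UnitAddCircle) = t :=
  AddCircle.equivIco_coe_of_mem (by rwa [zero_add])

lemma line_add_int (t : ℝ) (k : ℤ) : D.line (t + k) = D.line t := by
  rw [line, line]
  congr 1
  exact PlanarChart.coe_eq_coe_iff.2 ⟨k, rfl⟩

namespace Crossing

/-- The first parameter of a crossing. -/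
noncomputable def lo (x : D.Crossing) : ℝ := min (rep x.overParam) (rep x.underParam)

/-- The second parameter of a crossing. -/
noncomputable def hi (x : D.Crossing) : ℝ := max (rep x.overParam) (rep x.underParam)

lemma cases (x : D.Crossing) :
    (x.lo = rep x.underParam ∧ x.hi = rep x.overParam) ∨
      (x.lo = rep x.overParam ∧ x.hi = rep x.underParam) := by
  rcases le_total (rep x.overParam) (rep x.underParam) with h | h
  · exact Or.inr ⟨min_eq_left h, max_eq_right h⟩
  · exact Or.inl ⟨min_eq_right h, max_eq_left h⟩

lemma coe_cases (x : D.Crossing) :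
    ((x.lo : UnitAddCircle) = x.underParam ∧ (x.hi : UnitAddCircle) = x.overParam) ∨
      ((x.lo : UnitAddCircle) = x.overParam ∧ (x.hi : UnitAddCircle) = x.underParam) := by
  rcases x.cases with ⟨h, h'⟩ | ⟨h, h'⟩
  · left; rw [h, h', coe_rep, coe_rep]; exact ⟨rfl, rfl⟩
  · right; rw [h, h', coe_rep, coe_rep]; exact ⟨rfl, rfl⟩

lemma lo_lt_hi (x : D.Crossing) : x.lo < x.hi := by
  refine min_lt_max.2 fun h => x.ne ?_
  rw [← coe_rep x.overParam, h, coe_rep]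

lemma lo_nonneg (x : D.Crossing) : 0 ≤ x.lo := le_min (rep_mem _).1 (rep_mem _).1

lemma hi_lt_one (x : D.Crossing) : x.hi < 1 := max_lt (rep_mem _).2 (rep_mem _).2

lemma lo_mem (x : D.Crossing) : x.lo ∈ Ico (0 : ℝ) 1 :=
  ⟨x.lo_nonneg, x.lo_lt_hi.trans x.hi_lt_one⟩

lemma hi_mem (x : D.Crossing) : x.hi ∈ Ico (0 : ℝ) 1 :=
  ⟨x.lo_nonneg.trans x.lo_lt_hi.le, x.hi_lt_one⟩

lemma line_lo (x : D.Crossing) : D.line x.lo = x.point := by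
  rw [line, point]
  rcases x.coe_cases with ⟨h, -⟩ | ⟨h, -⟩
  · rw [h, x.curve_eq]
  · rw [h]

lemma line_hi (x : D.Crossing) : D.line x.hi = x.point := by
  rw [line, point]
  rcases x.coe_cases with ⟨-, h⟩ | ⟨-, h⟩
  · rw [h]
  · rw [h, x.curve_eq]

lemma coe_lo_ne_coe_hi (x : D.Crossing) : (x.lo : UnitAddCircle) ≠ (x.hi : UnitAddCircle) := by
  rcases x.coe_cases with ⟨h, h'⟩ | ⟨h, h'⟩ <;> rw [h, h']
  · exact x.ne.symm
  · exact x.ne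

/-- Without triple points the two crossings share both parameters, and `over_under` forbids
exchanging them. -/
lemma eq_of_point_eq {x z : D.Crossing} (h : x.point = z.point) : x = z := by
  have hx := x.curve_eq
  have hz := z.curve_eq
  rw [point, point] at h
  rcases D.no_triple x.overParam x.underParam z.overParam hx (hx.symm.trans h) with e | e | e
  · exact absurd e x.ne
  · exact absurd (e ▸ z.over_mem) ((D.over_under _ _ x.ne hx).1 x.over_mem)
  · rcases D.no_triple x.underParam z.overParam z.underParam (hx.symm.trans h) hz with e' | e' | e'
    · exact absurd (e.trans e'.symm) x.ne
    · exact absurd e' z.ne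
    · exact Crossing.ext e e'

lemma exists_of_line_eq {s t : ℝ} (hs : 0 ≤ s) (hst : s < t) (ht : t < 1)
    (h : D.line s = D.line t) : ∃ z : D.Crossing, z.lo = s ∧ z.hi = t := by
  have hsI : s ∈ Ico (0 : ℝ) 1 := ⟨hs, hst.trans ht⟩
  have htI : t ∈ Ico (0 : ℝ) 1 := ⟨hs.trans hst.le, ht⟩
  have hne : (s : UnitAddCircle) ≠ (t : UnitAddCircle) := fun e => by
    have := congrArg rep e
    rw [rep_coe hsI, rep_coe htI] at this
    exact hst.ne this
  by_cases ho : (s : UnitAddCircle) ∈ D.overParams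
  · refine ⟨⟨s, t, hne, h, ho⟩, ?_, ?_⟩
    · simp only [lo, rep_coe hsI, rep_coe htI, min_eq_left hst.le]
    · simp only [hi, rep_coe hsI, rep_coe htI, max_eq_right hst.le]
  · have ho' : (t : UnitAddCircle) ∈ D.overParams := by
      by_contra hc
      exact ho ((D.over_under _ _ hne h).2 hc)
    refine ⟨⟨t, s, hne.symm, h.symm, ho'⟩, ?_, ?_⟩
    · simp only [lo, rep_coe hsI, rep_coe htI, min_eq_right hst.le]
    · simp only [hi, rep_coe hsI, rep_coe htI, max_eq_left hst.le]

/-- Every parameter of a crossing other than `z` lies inside or outside the loop of `z`. -/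
lemma mem_Ioo_or_notMem_Icc {x z : D.Crossing} (hne : x ≠ z) {s : ℝ} (hs : D.line s = x.point) :
    s ∈ Ioo z.lo z.hi ∨ s ∉ Icc z.lo z.hi := by
  by_cases h : s ∈ Icc z.lo z.hi
  · left
    refine ⟨lt_of_le_of_ne h.1 ?_, lt_of_le_of_ne h.2 ?_⟩
    · rintro rfl
      exact hne (eq_of_point_eq (hs.symm.trans z.line_lo))
    · rintro rfl
      exact hne (eq_of_point_eq (hs.symm.trans z.line_hi))
  · exact Or.inr h

end Crossing

/-! ### Winding numbers of the loops of crossings; reducible crossings. -/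

namespace PlanarChart

variable (C : PlanarChart D)

lemma isDoublePoint_crossing (x : D.Crossing) : IsDoublePoint C.path x.lo x.hi :=
  C.isDoublePoint x.coe_lo_ne_coe_hi (x.line_lo.trans x.line_hi.symm)

lemma isLoop_crossing (x : D.Crossing) : IsLoop C.path x.lo x.hi :=
  C.isLoop x.lo_lt_hi (x.line_lo.trans x.line_hi.symm)

/-- The region at the corner of `x` between the ray `α` of the first strand and the ray `β` of the
second strand. -/
noncomputable def corner (x : D.Crossing) (α β : ℤˣ) : D.Region :=
  (exists_isCorner (C.isDoublePoint_crossing x) α β).choose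

lemma isCorner_corner (x : D.Crossing) (α β : ℤˣ) : C.IsCorner (C.corner x α β) x.lo x.hi α β :=
  (exists_isCorner (C.isDoublePoint_crossing x) α β).choose_spec

lemma isCorner_corner' (x : D.Crossing) (α β : ℤˣ) : C.IsCorner (C.corner x α β) x.hi x.lo β α :=
  (C.isCorner_corner x α β).symm (C.isDoublePoint_crossing x)

lemma eq_corner_iff (x : D.Crossing) (α β : ℤˣ) (R : D.Region) :
    R = C.corner x α β ↔ C.IsCorner R x.lo x.hi α β :=
  ⟨fun h => h ▸ C.isCorner_corner x α β, fun h => h.unique (C.isCorner_corner x α β)⟩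

/-- `corner` orders the strands by parameter, `TouchesAt` by under and over; the alternatives tell
whether the underpass comes first. -/
lemma touchesAt_cases (x : D.Crossing) :
    (∀ (R : D.Region) (ε δ : ℤˣ), R.TouchesAt x ε δ ↔ R = C.corner x ε δ) ∨
      ∀ (R : D.Region) (ε δ : ℤˣ), R.TouchesAt x ε δ ↔ R = C.corner x δ ε := by
  have hd := C.isDoublePoint_crossing x
  rcases x.coe_cases with ⟨h, h'⟩ | ⟨h, h'⟩
  · refine Or.inl fun R ε δ => ?_
    rw [C.eq_corner_iff]
    constructor
    · rintro ⟨η, a, b, ha, hb, h0, hη, hR⟩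
      refine isCorner_of_curve hd ha hb (h0.trans x.line_lo.symm) ?_ hR
      rwa [h, h']
    · intro hc
      obtain ⟨η, a, b, ha, hb, h0, hη, hR⟩ := hc.exists_curve hd
      rw [h, h'] at hη
      exact ⟨η, a, b, ha, hb, h0.trans x.line_lo, hη, hR⟩
  · refine Or.inr fun R ε δ => ?_
    rw [C.eq_corner_iff]
    constructor
    · rintro ⟨η, a, b, ha, hb, h0, hη, hR⟩
      refine isCorner_of_curve hd hb ha (h0.trans x.line_lo.symm) ?_ hR
      rwa [h, h', add_comm]
    · intro hc
      obtain ⟨η, a, b, ha, hb, h0, hη, hR⟩ := hc.exists_curve hd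
      rw [h, h', add_comm] at hη
      exact ⟨η, b, a, hb, ha, h0.trans x.line_lo, hη, hR⟩

variable {C}

lemma IsCorner.jump {s t a b : ℝ} {R R' : D.Region} {ε : ℤˣ} (hd : IsDoublePoint C.path s t)
    (h : C.IsCorner R s t ε 1) (h' : C.IsCorner R' s t ε (-1)) (hl : IsLoop C.path a b)
    (hab : b ≤ a + 1) (hin : ∀ᶠ c in 𝓝[>] (0 : ℝ), s + ((ε : ℤ) : ℝ) * c ∈ Ioo a b) :
    C.regionWind a b R - C.regionWind a b R' = IsDoublePoint.sign C.path s t := by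
  obtain ⟨x, h1, h2, h3⟩ := ((h.eventually_wind hl).and ((h'.eventually_wind hl).and
    (hd.wind_sub_wind hl hab ε hin))).exists
  rw [← h1, ← h2, h3]

lemma IsCorner.wind_eq {s t a b : ℝ} {R R' : D.Region} {ε : ℤˣ} (hd : IsDoublePoint C.path s t)
    (h : C.IsCorner R s t ε 1) (h' : C.IsCorner R' s t ε (-1)) (hl : IsLoop C.path a b)
    (hout : ∀ᶠ c in 𝓝[>] (0 : ℝ), ∀ k : ℤ, s + ((ε : ℤ) : ℝ) * c + k ∉ Icc a b) :
    C.regionWind a b R = C.regionWind a b R' := by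
  obtain ⟨x, h1, h2, h3⟩ := ((h.eventually_wind hl).and ((h'.eventually_wind hl).and
    (hd.wind_eq_wind_neg hl ε hout))).exists
  rw [← h1, ← h2, h3]

variable (C)

/-- Adjacent corners are separated by a strand, across which the winding number of the whole curve
jumps by `±1`. -/
lemma corner_ne (x : D.Crossing) (α : ℤˣ) :
    C.corner x α 1 ≠ C.corner x α (-1) ∧ C.corner x 1 α ≠ C.corner x (-1) α := by
  have h1 := x.lo_lt_hi
  have h2 := x.hi_lt_one
  have h3 := x.lo_nonneg
  -- With this base point both `x.lo` and `x.hi` are interior to the period `[a, a + 1]`.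
  set a := (x.lo + x.hi - 1) / 2 with ha
  have hl : IsLoop C.path a (a + 1) := C.isLoop (by linarith) (by
    simpa using (line_add_int (D := D) a 1).symm)
  constructor
  · intro h
    have := (C.isCorner_corner x α 1).jump (C.isDoublePoint_crossing x)
      (C.isCorner_corner x α (-1)) hl le_rfl
      (eventually_mem_of_mem_nhds α (Ioo_mem_nhds (by linarith) (by linarith)))
    rw [h, sub_self] at this
    exact Units.ne_zero _ this.symm
  · intro h
    have := (C.isCorner_corner' x 1 α).jump (C.isDoublePoint_crossing x).symm
      (C.isCorner_corner' x (-1) α) hl le_rfl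
      (eventually_mem_of_mem_nhds α (Ioo_mem_nhds (by linarith) (by linarith)))
    rw [h, sub_self] at this
    exact Units.ne_zero _ this.symm

/-- The winding number of the loop of `z` about a region. -/
noncomputable def loopWind (z : D.Crossing) (R : D.Region) : ℤ := C.regionWind z.lo z.hi R

lemma hi_le_lo_add_one (z : D.Crossing) : z.hi ≤ z.lo + 1 := by
  linarith [z.hi_lt_one, z.lo_nonneg]

lemma jump_lo {x z : D.Crossing} (α : ℤˣ)
    (h : ∀ᶠ c in 𝓝[>] (0 : ℝ), x.lo + ((α : ℤ) : ℝ) * c ∈ Ioo z.lo z.hi) :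
    C.loopWind z (C.corner x α 1) - C.loopWind z (C.corner x α (-1)) =
      IsDoublePoint.sign C.path x.lo x.hi :=
  (C.isCorner_corner x α 1).jump (C.isDoublePoint_crossing x) (C.isCorner_corner x α (-1))
    (C.isLoop_crossing z) (hi_le_lo_add_one z) h

lemma jump_hi {x z : D.Crossing} (β : ℤˣ)
    (h : ∀ᶠ c in 𝓝[>] (0 : ℝ), x.hi + ((β : ℤ) : ℝ) * c ∈ Ioo z.lo z.hi) :
    C.loopWind z (C.corner x 1 β) - C.loopWind z (C.corner x (-1) β) =
      IsDoublePoint.sign C.path x.hi x.lo :=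
  (C.isCorner_corner' x 1 β).jump (C.isDoublePoint_crossing x).symm (C.isCorner_corner' x (-1) β)
    (C.isLoop_crossing z) (hi_le_lo_add_one z) h

lemma eq_lo {x z : D.Crossing} (α : ℤˣ)
    (h : ∀ᶠ c in 𝓝[>] (0 : ℝ), x.lo + ((α : ℤ) : ℝ) * c ∉ Icc z.lo z.hi) :
    C.loopWind z (C.corner x α 1) = C.loopWind z (C.corner x α (-1)) :=
  (C.isCorner_corner x α 1).wind_eq (C.isDoublePoint_crossing x) (C.isCorner_corner x α (-1))
    (C.isLoop_crossing z)
    (eventually_forall_int_notMem_Icc z.lo_nonneg z.hi_lt_one x.lo_mem α h)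

lemma eq_hi {x z : D.Crossing} (β : ℤˣ)
    (h : ∀ᶠ c in 𝓝[>] (0 : ℝ), x.hi + ((β : ℤ) : ℝ) * c ∉ Icc z.lo z.hi) :
    C.loopWind z (C.corner x 1 β) = C.loopWind z (C.corner x (-1) β) :=
  (C.isCorner_corner' x 1 β).wind_eq (C.isDoublePoint_crossing x).symm
    (C.isCorner_corner' x (-1) β) (C.isLoop_crossing z)
    (eventually_forall_int_notMem_Icc z.lo_nonneg z.hi_lt_one x.hi_mem β h)

lemma eventually_Ioo {s a b : ℝ} (h : s ∈ Ioo a b) (ε : ℤˣ) :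
    ∀ᶠ c in 𝓝[>] (0 : ℝ), s + ((ε : ℤ) : ℝ) * c ∈ Ioo a b :=
  eventually_mem_of_mem_nhds ε (Ioo_mem_nhds h.1 h.2)

lemma eventually_notMem_Icc {s a b : ℝ} (h : s ∉ Icc a b) (ε : ℤˣ) :
    ∀ᶠ c in 𝓝[>] (0 : ℝ), s + ((ε : ℤ) : ℝ) * c ∉ Icc a b :=
  eventually_mem_of_mem_nhds ε (isClosed_Icc.isOpen_compl.mem_nhds h)

/-- The alternating sum of the winding numbers at the corners of another crossing vanishes. -/
lemma loopWind_alternating {x z : D.Crossing} (hne : x ≠ z) :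
    C.loopWind z (C.corner x 1 1) - C.loopWind z (C.corner x 1 (-1)) =
      C.loopWind z (C.corner x (-1) 1) - C.loopWind z (C.corner x (-1) (-1)) := by
  -- Across the two rays of the first strand the jumps are the same sign if the strand is in the
  -- loop, and both zero if not.
  rcases Crossing.mem_Ioo_or_notMem_Icc hne x.line_lo with h | h
  · rw [C.jump_lo 1 (eventually_Ioo h _), C.jump_lo (-1) (eventually_Ioo h _)]
  · rw [C.eq_lo 1 (eventually_notMem_Icc h _), C.eq_lo (-1) (eventually_notMem_Icc h _), sub_self,
      sub_self]

/-- A crossing is reducible if some region touches it at opposite corners. -/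
def Reducible (x : D.Crossing) : Prop := ∃ α β, C.corner x α β = C.corner x (-α) (-β)

/-- A reducible crossing is not interleaved with another crossing. -/
lemma Reducible.not_interleaved {x z : D.Crossing} (hx : C.Reducible x) (hne : x ≠ z) :
    x.lo ∈ Ioo z.lo z.hi ↔ x.hi ∈ Ioo z.lo z.hi := by
  obtain ⟨α, β, hαβ⟩ := hx
  have key : C.loopWind z (C.corner x α β) = C.loopWind z (C.corner x (-α) (-β)) := by rw [hαβ]
  have hsgn : ∀ u : ℤˣ, (u : ℤ) ≠ 0 := fun u => u.ne_zero
  have hs1 := hsgn (IsDoublePoint.sign C.path x.lo x.hi)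
  have hs2 := hsgn (IsDoublePoint.sign C.path x.hi x.lo)
  rcases Crossing.mem_Ioo_or_notMem_Icc hne x.line_lo with h | h <;>
    rcases Crossing.mem_Ioo_or_notMem_Icc hne x.line_hi with h' | h'
  · exact iff_of_true h h'
  -- Passing the first strand changes the winding number by `±1`, passing the second does not change
  -- it, so opposite corners would have different winding numbers.
  · exfalso
    have e1 := C.jump_lo 1 (eventually_Ioo h _)
    have e2 := C.jump_lo (-1) (eventually_Ioo h _)
    have e3 := C.eq_hi 1 (eventually_notMem_Icc h' _)
    have e4 := C.eq_hi (-1) (eventually_notMem_Icc h' _)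
    rcases Int.units_eq_one_or α with rfl | rfl <;> rcases Int.units_eq_one_or β with rfl | rfl <;>
      (try simp only [neg_neg] at key) <;> omega
  · exfalso
    have e1 := C.jump_hi 1 (eventually_Ioo h' _)
    have e2 := C.jump_hi (-1) (eventually_Ioo h' _)
    have e3 := C.eq_lo 1 (eventually_notMem_Icc h _)
    have e4 := C.eq_lo (-1) (eventually_notMem_Icc h _)
    rcases Int.units_eq_one_or α with rfl | rfl <;> rcases Int.units_eq_one_or β with rfl | rfl <;>
      (try simp only [neg_neg] at key) <;> omega
  · exact iff_of_false (fun hh => h (Ioo_subset_Icc_self hh)) fun hh => h' (Ioo_subset_Icc_self hh)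

/-- The winding numbers of the loop of `x` at the corners of `x`. -/
lemma loopWind_self (x : D.Crossing) :
    C.loopWind x (C.corner x 1 1) = C.loopWind x (C.corner x (-1) 1) ∧
    C.loopWind x (C.corner x (-1) (-1)) = C.loopWind x (C.corner x (-1) 1) ∧
    C.loopWind x (C.corner x 1 (-1)) - C.loopWind x (C.corner x (-1) 1) =
      -(IsDoublePoint.sign C.path x.lo x.hi : ℤ) := by
  have hlt := x.lo_lt_hi
  -- The loop leaves along the ray `1` of the first strand and returns along the ray `-1` of the
  -- second; the other two rays are outside it. Only the corner `(1, -1)` is cut off by the loop.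
  have e1 := C.eq_lo (x := x) (z := x) (-1) (by
    filter_upwards [self_mem_nhdsWithin] with c hc hmem
    have hc : 0 < c := hc
    have := hmem.1
    simp at this
    linarith)
  have e2 := C.eq_hi (x := x) (z := x) 1 (by
    filter_upwards [self_mem_nhdsWithin] with c hc hmem
    have hc : 0 < c := hc
    have := hmem.2
    simp at this
    linarith)
  have e3 := C.jump_lo (x := x) (z := x) 1 (by
    filter_upwards [Ioo_mem_nhdsGT (sub_pos.2 hlt)] with c hc
    have h1 := hc.1
    have h2 := hc.2
    constructor <;> simp <;> linarith)
  refine ⟨e2, e1.symm, ?_⟩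
  rw [← e3, e2]
  ring

/-- The rest of the curve avoids the loop of a reducible crossing. -/
lemma Reducible.path_notMem {x : D.Crossing} (hx : C.Reducible x) {τ : ℝ}
    (hτ : τ ∈ Ioo x.hi (x.lo + 1)) : C.path τ ∉ C.path '' Icc x.lo x.hi := by
  rintro ⟨σ, hσ, he⟩
  rw [C.path_eq_iff] at he
  have hx0 := x.lo_nonneg
  have hx1 := x.hi_lt_one
  obtain ⟨h1, h2⟩ := hτ
  obtain ⟨h3, h4⟩ := hσ
  have hend : ∀ z : D.Crossing, z.point = D.line σ →
      (x.lo ∈ Ioo z.lo z.hi ↔ x.hi ∈ Ioo z.lo z.hi) ∨ z = x := fun z hz => by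
    by_cases hzx : z = x
    · exact Or.inr hzx
    · exact Or.inl (hx.not_interleaved C fun h => hzx h.symm)
  have hmid : ∀ z : D.Crossing, z.point = D.line σ → z ≠ x → x.lo < σ ∧ σ < x.hi :=
    fun z hz hzx => by
      rcases Crossing.mem_Ioo_or_notMem_Icc hzx hz.symm with h | h
      · exact h
      · exact absurd ⟨h3, h4⟩ h
  -- A meeting point would be a crossing interleaved with `x`. Parameters of crossings are taken in
  -- `[0, 1)`, so `τ` must be shifted back if it has passed `1`, and then it comes before `σ`.
  rcases lt_or_ge τ 1 with hτ1 | hτ1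
  · obtain ⟨z, hz1, hz2⟩ := Crossing.exists_of_line_eq (D := D) (s := σ) (t := τ) (by linarith)
      (by linarith) hτ1 he
    have hzp : z.point = D.line σ := by rw [← z.line_lo, hz1]
    rcases hend z hzp with h | h
    · have hzx : z ≠ x := by
        rintro rfl
        linarith
      obtain ⟨h5, h6⟩ := hmid z hzp hzx
      have := (h.2 ⟨by linarith, by linarith⟩).1
      linarith
    · rw [h] at hz2
      linarith
  · have he' : D.line (τ - 1) = D.line σ := by
      rw [he]
      have := line_add_int (D := D) (τ - 1) 1
      simpa using this.symm
    obtain ⟨z, hz1, hz2⟩ := Crossing.exists_of_line_eq (D := D) (s := τ - 1) (t := σ) (by linarith)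
      (by linarith) (by linarith) he'
    have hzp : z.point = D.line σ := by rw [← z.line_hi, hz2]
    rcases hend z hzp with h | h
    · have hzx : z ≠ x := by
        rintro rfl
        linarith
      obtain ⟨h5, h6⟩ := hmid z hzp hzx
      have := (h.1 ⟨by linarith, by linarith⟩).2
      linarith
    · rw [h] at hz1
      linarith

/-- The winding number of the loop of a reducible crossing `x` is constant at the corners which
lie on the rest of the curve. -/
lemma Reducible.loopWind_eq {x y : D.Crossing} (hx : C.Reducible x)
    (hy : y.lo ∉ Icc x.lo x.hi) (α β : ℤˣ) :
    C.loopWind x (C.corner y α β) = C.loopWind x (C.corner x (-1) 1) := by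
  have hx0 := x.lo_nonneg
  have hx1 := x.hi_lt_one
  have hlt := x.lo_lt_hi
  have hl := C.isLoop_crossing x
  -- The complementary open arc is connected and misses the loop.
  have hconst : ∀ τ ∈ Ioo x.hi (x.lo + 1), ∀ τ' ∈ Ioo x.hi (x.lo + 1),
      wind C.path x.lo x.hi (C.path τ) = wind C.path x.lo x.hi (C.path τ') := by
    intro τ hτ τ' hτ'
    refine hl.wind_eq_of_isPreconnected (s := C.path '' Ioo x.hi (x.lo + 1))
      (isPreconnected_Ioo.image _ C.smooth.continuous.continuousOn) ?_ (mem_image_of_mem _ hτ)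
      (mem_image_of_mem _ hτ')
    rintro _ ⟨r, hr, rfl⟩
    exact hx.path_notMem C hr
  -- The corner `(-1, 1)` of `x` borders the beginning of the complementary arc, just after `x.hi`.
  obtain ⟨τ, hτ, hτx⟩ : ∃ τ ∈ Ioo x.hi (x.lo + 1),
      C.loopWind x (C.corner x (-1) 1) = wind C.path x.lo x.hi (C.path τ) := by
    obtain ⟨h, h1, c, hc0, hc1, hc⟩ := (((C.isCorner_corner' x (-1) 1).eventually_wind hl).and
      ((C.isDoublePoint_crossing x).symm.wind_eq_wind hl 1
        (eventually_forall_int_notMem_Icc hx0 hx1 x.hi_mem 1 (by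
          filter_upwards [self_mem_nhdsWithin] with c hc hmem
          have hc : 0 < c := hc
          have := hmem.2
          simp at this
          linarith)) (show 0 < x.lo + 1 - x.hi by linarith))).exists
    refine ⟨x.hi + c, ⟨by linarith, by linarith⟩, ?_⟩
    rw [loopWind, ← h1, hc]
    simp
  obtain ⟨τ', hτ', hτy⟩ : ∃ τ ∈ Ioo x.hi (x.lo + 1),
      C.loopWind x (C.corner y α β) = wind C.path x.lo x.hi (C.path τ) := by
    -- The complementary arc extends past `1`, so a parameter below `x.lo` is seen there after one
    -- period.
    have hk : ∃ k : ℤ, y.lo + k ∈ Ioo x.hi (x.lo + 1) := by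
      by_cases h : y.lo < x.lo
      · exact ⟨1, by push_cast; linarith [y.lo_nonneg], by push_cast; linarith⟩
      · refine ⟨0, ?_, ?_⟩
        · by_contra hcon
          push_cast at hcon
          exact hy ⟨not_lt.1 h, by linarith⟩
        · push_cast
          linarith [y.lo_mem.2]
    obtain ⟨k, hk⟩ := hk
    obtain ⟨r, hr, hsub⟩ := Metric.isOpen_iff.1 isOpen_Ioo _ hk
    obtain ⟨h, h1, c, hc0, hc1, hc⟩ := (((C.isCorner_corner y α β).eventually_wind hl).and
      ((C.isDoublePoint_crossing y).wind_eq_wind hl α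
        (eventually_forall_int_notMem_Icc hx0 hx1 y.lo_mem α (eventually_notMem_Icc hy α))
        hr)).exists
    refine ⟨y.lo + ((α : ℤ) : ℝ) * c + k, hsub ?_, ?_⟩
    · rw [Metric.mem_ball, Real.dist_eq]
      have : y.lo + ((α : ℤ) : ℝ) * c + k - (y.lo + k) = ((α : ℤ) : ℝ) * c := by ring
      rw [this]
      rcases Int.units_eq_one_or α with rfl | rfl <;> simpa [abs_of_pos hc0] using hc1
    · rw [loopWind, ← h1, hc, path, path, line_add_int]
  rw [hτx, hτy, hconst τ' hτ' τ hτ]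

end PlanarChart
end KnotDiagram

end

/-! ### Triangular integer systems and the matrix rows. -/

section

open Set Filter

/-! ### Linear algebra -/

/-- A submodule of `ℤⁿ` is everything if it contains, for each index `i`, a vector which is a unit
at `i` and whose other nonzero coordinates are smaller than `i`, or belong to a set of indices for
which such smaller vectors exist. -/
lemma submodule_eq_top_of_triangular {ι : Type*} [Finite ι] [DecidableEq ι]
    (M : Submodule ℤ (ι → ℤ)) (red : ι → Prop) (r : ι → ι → Prop) [IsTrans ι r] [Std.Irrefl r]
    (h : ∀ i, ∃ v ∈ M, IsUnit (v i) ∧ ∀ j, j ≠ i → v j ≠ 0 → red j ∧ (red i → r j i)) :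
    M = ⊤ := by
  have := Fintype.ofFinite ι
  have key : ∀ i, (∀ j, j ≠ i → red j → (red i → r j i) → Pi.single j (1 : ℤ) ∈ M) →
      Pi.single i (1 : ℤ) ∈ M := by
    intro i hi
    obtain ⟨v, hv, ⟨u, hu⟩, hvj⟩ := h i
    have hmem : ∀ j ∈ Finset.univ.erase i, v j • Pi.single j (1 : ℤ) ∈ M := by
      intro j hj
      by_cases h0 : v j = 0
      · rw [h0, zero_smul]
        exact M.zero_mem
      · obtain ⟨h1, h2⟩ := hvj j (Finset.ne_of_mem_erase hj) h0
        exact M.smul_mem _ (hi j (Finset.ne_of_mem_erase hj) h1 h2)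
    have hsum : v = v i • Pi.single i (1 : ℤ) +
        ∑ j ∈ Finset.univ.erase i, v j • Pi.single j (1 : ℤ) := by
      rw [Finset.add_sum_erase _ (fun j => v j • Pi.single j (1 : ℤ)) (Finset.mem_univ i)]
      exact pi_eq_sum_univ' v
    have hvi : v i • Pi.single i (1 : ℤ) ∈ M := by
      rw [← sub_eq_of_eq_add hsum]
      exact M.sub_mem hv (M.sum_mem hmem)
    have := M.smul_mem ((u⁻¹ : ℤˣ) : ℤ) hvi
    rwa [← hu, smul_smul, Units.inv_mul, one_smul] at this
  -- Induction along `r` yields the unit vectors of the indices in `red`; every other index then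
  -- needs only these.
  have hred : ∀ i, red i → Pi.single i (1 : ℤ) ∈ M := by
    intro i
    induction i using (Finite.wellFounded_of_trans_of_irrefl r).induction with
    | _ i ih => exact fun hi => key i fun j _ hj hr => ih j (hr hi) hj
  have hall : ∀ i, Pi.single i (1 : ℤ) ∈ M := fun i => key i fun j _ hj _ => hred j hj
  rw [eq_top_iff]
  intro v _
  rw [pi_eq_sum_univ' v]
  exact M.sum_mem fun i _ => M.smul_mem _ (hall i)

lemma matMul_eq {I J : Type} (A : Matrix I J ℤ) (u : J →₀ ℤ) :
    matMul A u = Finsupp.linearCombination ℤ (fun j i => A i j) u := by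
  funext i
  simp [matMul, Finsupp.linearCombination_apply, Finsupp.sum, mul_comm]

lemma matMul_solvable {n : ℕ} {J : Type} (A : Matrix (Fin n) J ℤ) (red : Fin n → Prop)
    (r : Fin n → Fin n → Prop) [IsTrans (Fin n) r] [Std.Irrefl r]
    (h : ∀ i, ∃ u : J →₀ ℤ, IsUnit (matMul A u i) ∧
      ∀ j, j ≠ i → matMul A u j ≠ 0 → red j ∧ (red i → r j i)) (c : Fin n → ℤ) :
    ∃ u : J →₀ ℤ, matMul A u + c = 0 := by
  have htop := submodule_eq_top_of_triangular
    (LinearMap.range (Finsupp.linearCombination ℤ (fun j i => A i j))) red r fun i => by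
      obtain ⟨u, hu⟩ := h i
      exact ⟨_, ⟨u, (matMul_eq A u).symm⟩, hu⟩
  obtain ⟨u, hu⟩ : -c ∈ LinearMap.range (Finsupp.linearCombination ℤ (fun j i => A i j)) := by
    rw [htop]
    trivial
  exact ⟨u, by rw [matMul_eq, hu, neg_add_cancel]⟩

/-! ### Matrix entries from the regions at the four corners -/

section Corners

variable {X : Type*} (c : ℤˣ → ℤˣ → X) (κ : ℤˣ)

lemma exists_units_iff {p : ℤˣ → ℤˣ → Prop} :
    (∃ α β, p α β) ↔ p 1 1 ∨ p 1 (-1) ∨ p (-1) 1 ∨ p (-1) (-1) := by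
  constructor
  · rintro ⟨α, β, h⟩
    rcases Int.units_eq_one_or α with rfl | rfl <;> rcases Int.units_eq_one_or β with rfl | rfl <;>
      tauto
  · rintro (h | h | h | h) <;> exact ⟨_, _, h⟩

open Classical in
/-- The entry of the single counting rule, if `c α β` is the region at the corner `(α, β)`. -/
noncomputable def cornerSingle (R : X) : ℤ :=
  if ∃ α β, α * β = κ ∧ R = c α β then 1
  else if ∃ α β, α * β = -κ ∧ R = c α β then -1
  else 0

open Classical in
/-- The entry of the double counting rule, if `c α β` is the region at the corner `(α, β)`. -/
noncomputable def cornerDouble (R : X) : ℤ :=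
  if ∃ α β, R = c α β ∧ R = c (-α) (-β) then 2 * cornerSingle c κ R else cornerSingle c κ R

open Classical in
/-- The number of corners at the region `R`, counted with signs. -/
noncomputable def cornerCount (R : X) : ℤ :=
  (κ : ℤ) * ((if c 1 1 = R then 1 else 0) - (if c 1 (-1) = R then 1 else 0) -
    ((if c (-1) 1 = R then 1 else 0) - if c (-1) (-1) = R then 1 else 0))

variable {c κ}

/-- Since adjacent corners belong to different regions, a region occupies at most one corner or two
opposite corners. Opposite corners have equal sign, so the doubled entry is the signed count of
corners, which is easy to sum. -/
lemma cornerDouble_eq_cornerCount (hadj : ∀ α, c α 1 ≠ c α (-1) ∧ c 1 α ≠ c (-1) α) (R : X) :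
    cornerDouble c κ R = cornerCount c κ R := by
  have h1 := (hadj 1).1
  have h2 := (hadj (-1)).1
  have h3 := (hadj 1).2
  have h4 := (hadj (-1)).2
  have hne : (1 : ℤˣ) ≠ -1 := by decide
  classical
  simp only [cornerDouble, cornerSingle, cornerCount, exists_units_iff, neg_neg, eq_comm (a := R)]
  by_cases e1 : c 1 1 = R
  · have e2 : ¬c 1 (-1) = R := fun e => h1 (e1.trans e.symm)
    have e3 : ¬c (-1) 1 = R := fun e => h3 (e1.trans e.symm)
    by_cases e4 : c (-1) (-1) = R <;> rcases Int.units_eq_one_or κ with rfl | rfl <;>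
      simp [e1, e2, e3, e4, hne, hne.symm]
  · by_cases e4 : c (-1) (-1) = R
    · have e2 : ¬c 1 (-1) = R := fun e => h4 (e.trans e4.symm)
      have e3 : ¬c (-1) 1 = R := fun e => h2 (e.trans e4.symm)
      rcases Int.units_eq_one_or κ with rfl | rfl <;> simp [e1, e2, e3, e4, hne, hne.symm]
    · by_cases e2 : c 1 (-1) = R <;> by_cases e3 : c (-1) 1 = R <;>
        rcases Int.units_eq_one_or κ with rfl | rfl <;> simp [e1, e2, e3, e4, hne, hne.symm]

lemma cornerSingle_eq_cornerDouble (h : ∀ α β, c α β ≠ c (-α) (-β)) (R : X) :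
    cornerSingle c κ R = cornerDouble c κ R := by
  rw [cornerDouble, if_neg]
  rintro ⟨α, β, h1, h2⟩
  exact h α β (h1.symm.trans h2)

lemma cornerSingle_eq_zero {R : X} (h : ∀ α β, R ≠ c α β) : cornerSingle c κ R = 0 := by
  rw [cornerSingle, if_neg, if_neg] <;> rintro ⟨α, β, -, h'⟩ <;> exact h α β h'

lemma cornerDouble_eq_zero {R : X} (h : ∀ α β, R ≠ c α β) : cornerDouble c κ R = 0 := by
  rw [cornerDouble, cornerSingle_eq_zero h, mul_zero, ite_self]

lemma isUnit_cornerSingle (α β : ℤˣ) : IsUnit (cornerSingle c κ (c α β)) := by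
  by_cases h : α * β = κ
  · rw [cornerSingle, if_pos ⟨α, β, h, rfl⟩]
    exact isUnit_one
  · have h' : α * β = -κ := Int.units_ne_iff_eq_neg.1 h
    rw [cornerSingle]
    split_ifs with h1 h2
    · exact isUnit_one
    · exact isUnit_one.neg
    · exact absurd ⟨α, β, h', rfl⟩ h2

lemma isUnit_cornerDouble {α β : ℤˣ} (h : ∀ α' β', c α' β' = c α β → α' = α ∧ β' = β) :
    IsUnit (cornerDouble c κ (c α β)) := by
  rw [cornerDouble, if_neg]
  · exact isUnit_cornerSingle α β
  · rintro ⟨α', β', h1, h2⟩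
    have e1 := (h _ _ h1.symm).1
    have e2 := (h _ _ h2.symm).1
    rw [← e1] at e2
    rcases Int.units_eq_one_or α' with rfl | rfl <;> simp at e2

lemma sum_cornerCount (T : Finset X) (hT : ∀ α β, c α β ∈ T) (w : X → ℤ) :
    ∑ R ∈ T, cornerCount c κ R * w R =
      κ * (w (c 1 1) - w (c 1 (-1)) - (w (c (-1) 1) - w (c (-1) (-1)))) := by
  classical
  simp only [cornerCount, mul_assoc, ← Finset.mul_sum]
  congr 1
  simp only [sub_mul, ite_mul, one_mul, zero_mul, Finset.sum_sub_distrib, Finset.sum_ite_eq, hT,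
    if_true]

end Corners

/-! ### The matrices applied to normalized winding numbers. -/

namespace KnotDiagram

variable {E : Type} [NormedAddCommGroup E] [NormedSpace ℝ E] {S : OrientedSurface E}
  {D : KnotDiagram S}

/-- The area form is nonzero and bilinear with respect to signs at the crossing `x`, so that the
signs of the corners at `x` alternate. -/
def Crossing.HasSign (x : D.Crossing) (κ : ℤˣ) : Prop :=
  ∀ ε δ : ℤˣ, (x.IsPosCorner ε δ ↔ ε * δ = κ) ∧ (x.IsNegCorner ε δ ↔ ε * δ = -κ)

namespace PlanarChart

variable (C : PlanarChart D)

lemma entrySingle_eq {x : D.Crossing} {κ : ℤˣ} (h : x.HasSign κ) (R : D.Region) :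
    entrySingle x R = cornerSingle (C.corner x) κ R := by
  have key : ∀ κ' : ℤˣ, (∃ ε δ, ε * δ = κ' ∧ R.TouchesAt x ε δ) ↔
      ∃ α β, α * β = κ' ∧ R = C.corner x α β := by
    intro κ'
    rcases C.touchesAt_cases x with ht | ht
    · simp only [ht]
    · rw [exists_comm]
      simp only [ht, mul_comm]
  classical
  refine if_congr (Iff.trans ?_ (key κ)) rfl (if_congr (Iff.trans ?_ (key (-κ))) rfl rfl)
  · simp only [(h _ _).1]
  · simp only [(h _ _).2]

lemma entryDouble_eq {x : D.Crossing} {κ : ℤˣ} (h : x.HasSign κ) (R : D.Region) :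
    entryDouble x R = cornerDouble (C.corner x) κ R := by
  have ht : R.TouchesTwice x ↔ ∃ α β, R = C.corner x α β ∧ R = C.corner x (-α) (-β) := by
    rw [Region.TouchesTwice]
    rcases C.touchesAt_cases x with ht | ht
    · simp only [ht]
    · simp only [ht]
      exact exists_comm
  classical
  simp only [entryDouble, cornerDouble, C.entrySingle_eq h]
  exact if_congr ht rfl rfl

/-- The winding number of the loop of `x`, normalized to vanish at three corners of `x`. -/
noncomputable def normalizedWind (x : D.Crossing) (R : D.Region) : ℤ :=
  C.loopWind x R - C.loopWind x (C.corner x (-1) 1)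

lemma normalizedWind_corner (x : D.Crossing) (α β : ℤˣ) (h : ¬(α = 1 ∧ β = -1)) :
    C.normalizedWind x (C.corner x α β) = 0 := by
  obtain ⟨h1, h2, -⟩ := C.loopWind_self x
  rw [normalizedWind, sub_eq_zero]
  rcases Int.units_eq_one_or α with rfl | rfl <;> rcases Int.units_eq_one_or β with rfl | rfl
  · exact h1
  · exact absurd ⟨rfl, rfl⟩ h
  · rfl
  · exact h2

lemma isUnit_normalizedWind_corner (x : D.Crossing) :
    IsUnit (C.normalizedWind x (C.corner x 1 (-1))) := by
  rw [normalizedWind, (C.loopWind_self x).2.2]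
  exact (Units.isUnit _).neg

/-- The normalized winding number is nonzero at the corner `(1, -1)` and zero at the other three.
Hence the double rule does not double the entry there, which remains a unit. -/
lemma eq_of_corner_eq (x : D.Crossing) (α β : ℤˣ) (h : C.corner x α β = C.corner x 1 (-1)) :
    α = 1 ∧ β = -1 := by
  by_contra hcon
  have h0 := C.normalizedWind_corner x α β hcon
  rw [h] at h0
  exact (C.isUnit_normalizedWind_corner x).ne_zero h0

/-- If the entries of the matrix row of `x` are units at the corner `(1, -1)` and vanish at the
regions which do not touch `x`, then its product with the normalized winding number is a unit. -/
lemma isUnit_sum (x : D.Crossing) {T : Finset D.Region} (hT : ∀ α β, C.corner x α β ∈ T)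
    {f : D.Region → ℤ} (h0 : ∀ R, (∀ α β, R ≠ C.corner x α β) → f R = 0)
    (h1 : IsUnit (f (C.corner x 1 (-1)))) : IsUnit (∑ R ∈ T, f R * C.normalizedWind x R) := by
  rw [Finset.sum_eq_single_of_mem _ (hT 1 (-1))]
  · exact h1.mul (C.isUnit_normalizedWind_corner x)
  · intro R _ hR
    by_cases h : ∃ α β, R = C.corner x α β
    · obtain ⟨α, β, rfl⟩ := h
      rw [C.normalizedWind_corner x α β, mul_zero]
      rintro ⟨rfl, rfl⟩
      exact hR rfl
    · simp only [not_exists] at h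
      rw [h0 R h, zero_mul]

/-- The constant subtracted in the normalization cancels in the alternating sum. -/
lemma sum_cornerDouble_eq_zero {x z : D.Crossing} (hne : x ≠ z) {T : Finset D.Region}
    (hT : ∀ α β, C.corner x α β ∈ T) (κ : ℤˣ) :
    ∑ R ∈ T, cornerDouble (C.corner x) κ R * C.normalizedWind z R = 0 := by
  simp only [cornerDouble_eq_cornerCount (C.corner_ne x)]
  rw [sum_cornerCount T hT]
  have := C.loopWind_alternating hne
  simp only [normalizedWind]
  rw [show ∀ a b c d e : ℤ, a - e - (b - e) - (c - e - (d - e)) = a - b - (c - d) by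
    intros; ring, this, sub_self, mul_zero]

lemma sum_cornerSingle_eq_zero {x z : D.Crossing} (hne : x ≠ z) {T : Finset D.Region}
    (hT : ∀ α β, C.corner x α β ∈ T) (κ : ℤˣ) (h : ¬C.Reducible x) :
    ∑ R ∈ T, cornerSingle (C.corner x) κ R * C.normalizedWind z R = 0 := by
  rw [← C.sum_cornerDouble_eq_zero hne hT κ]
  refine Finset.sum_congr rfl fun R _ => ?_
  rw [cornerSingle_eq_cornerDouble]
  exact fun α β h' => h ⟨α, β, h'⟩

/-- The loop of `y` lies strictly inside the loop of `x`. -/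
def Nested (y x : D.Crossing) : Prop := x.lo < y.lo ∧ y.hi < x.hi

lemma sum_cornerSingle_eq_zero_of_not_nested {x z : D.Crossing} (hne : x ≠ z)
    {T : Finset D.Region} (κ : ℤˣ) (hx : C.Reducible x) (hz : C.Reducible z) (h : ¬Nested x z) :
    ∑ R ∈ T, cornerSingle (C.corner x) κ R * C.normalizedWind z R = 0 := by
  -- As `x` is reducible, `x.lo` in the loop of `z` would bring `x.hi` along, and `x` would be
  -- nested in `z`.
  have hlo : x.lo ∉ Set.Icc z.lo z.hi := by
    intro hmem
    rcases Crossing.mem_Ioo_or_notMem_Icc hne x.line_lo with h1 | h1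
    · exact h ⟨h1.1, ((hx.not_interleaved C hne).1 h1).2⟩
    · exact h1 hmem
  refine Finset.sum_eq_zero fun R _ => ?_
  by_cases hR : ∃ α β, R = C.corner x α β
  · obtain ⟨α, β, rfl⟩ := hR
    rw [normalizedWind, hz.loopWind_eq C hlo, sub_self, mul_zero]
  · simp only [not_exists] at hR
    rw [cornerSingle_eq_zero hR, zero_mul]

end PlanarChart

/-- The unknowns of a linear system restricted to finitely many regions. -/
lemma matMul_onFinset {I J : Type} (A : Matrix I J ℤ) (T : Finset J) (w : J → ℤ) :
    ∃ u : J →₀ ℤ, ∀ i, matMul A u i = ∑ j ∈ T, A i j * w j := by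
  refine ⟨∑ j ∈ T, Finsupp.single j (w j), fun i => ?_⟩
  rw [matMul_eq, map_sum, Finset.sum_apply]
  simp [mul_comm]

theorem solvable_of_planarChart (C : PlanarChart D) (hsign : ∀ x : D.Crossing, ∃ κ, x.HasSign κ)
    {n : ℕ} (x : Fin n ≃ D.Crossing) :
    (∀ c : Fin n → ℤ, ∃ u : D.Region →₀ ℤ, matMul (D.alternatingSingle x) u + c = 0) ∧
    (∀ c : Fin n → ℤ, ∃ u : D.Region →₀ ℤ, matMul (D.alternatingDouble x) u + c = 0) := by
  classical
  choose κ hκ using hsign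
  -- The regions touching some crossing. All other columns are zero, so truncating the winding
  -- vector to `T` makes it finitely supported without changing the product.
  let T : Finset D.Region := Finset.univ.image
    fun q : Fin n × ℤˣ × ℤˣ => C.corner (x q.1) q.2.1 q.2.2
  have hT : ∀ i α β, C.corner (x i) α β ∈ T := fun i α β =>
    Finset.mem_image.2 ⟨(i, α, β), Finset.mem_univ _, rfl⟩
  have hne : ∀ {i j}, j ≠ i → x j ≠ x i := fun h => x.injective.ne h
  let r : Fin n → Fin n → Prop := fun j i => PlanarChart.Nested (x j) (x i)
  have : IsTrans (Fin n) r := ⟨fun _ _ _ h h' => ⟨h'.1.trans h.1, h.2.trans h'.2⟩⟩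
  have : Std.Irrefl r := ⟨fun _ h => lt_irrefl _ h.1⟩
  constructor
  · refine matMul_solvable _ (fun i => C.Reducible (x i)) r fun i => ?_
    obtain ⟨u, hu⟩ := matMul_onFinset (D.alternatingSingle x) T (C.normalizedWind (x i))
    have hu' : ∀ j, matMul (D.alternatingSingle x) u j = ∑ R ∈ T,
        cornerSingle (C.corner (x j)) (κ (x j)) R * C.normalizedWind (x i) R := fun j => by
      rw [hu]
      exact Finset.sum_congr rfl fun R _ => by
        rw [alternatingSingle, Matrix.of_apply, C.entrySingle_eq (hκ _)]
    refine ⟨u, ?_, fun j hj h0 => ?_⟩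
    · rw [hu']
      exact C.isUnit_sum (x i) (hT i) (fun R => cornerSingle_eq_zero) (isUnit_cornerSingle _ _)
    · rw [hu'] at h0
      have hred : C.Reducible (x j) := by
        by_contra h
        exact h0 (C.sum_cornerSingle_eq_zero (hne hj) (hT j) _ h)
      refine ⟨hred, fun hi => ?_⟩
      by_contra h
      exact h0 (C.sum_cornerSingle_eq_zero_of_not_nested (hne hj) _ hred hi h)
  -- For the double rule all off-diagonal entries vanish, so no index has to serve as a correction.
  · refine matMul_solvable _ (fun _ => False) r fun i => ?_
    obtain ⟨u, hu⟩ := matMul_onFinset (D.alternatingDouble x) T (C.normalizedWind (x i))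
    have hu' : ∀ j, matMul (D.alternatingDouble x) u j = ∑ R ∈ T,
        cornerDouble (C.corner (x j)) (κ (x j)) R * C.normalizedWind (x i) R := fun j => by
      rw [hu]
      exact Finset.sum_congr rfl fun R _ => by
        rw [alternatingDouble, Matrix.of_apply, C.entryDouble_eq (hκ _)]
    refine ⟨u, ?_, fun j hj h0 => ?_⟩
    · rw [hu']
      exact C.isUnit_sum (x i) (hT i) (fun R => cornerDouble_eq_zero)
        (isUnit_cornerDouble (C.eq_of_corner_eq (x i)))
    · rw [hu'] at h0
      exact absurd (C.sum_cornerDouble_eq_zero (hne hj) (hT j) _) h0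

end KnotDiagram

end

/-! ### Charts and corner signs for the plane and the sphere. -/

section

open Set Filter

namespace KnotDiagram

section Sign

variable {E : Type} [NormedAddCommGroup E] [NormedSpace ℝ E] {S : OrientedSurface E}
  {D : KnotDiagram S}

lemma Crossing.exists_hasSign (x : D.Crossing)
    (h0 : S.area x.point (D.velocity x.underParam) (D.velocity x.overParam) ≠ 0)
    (hneg : ∀ v w, S.area x.point (-v) w = -S.area x.point v w ∧
      S.area x.point v (-w) = -S.area x.point v w) : ∃ κ, x.HasSign κ := by
  have hne : (1 : ℤˣ) ≠ -1 := by decide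
  rcases lt_or_gt_of_ne h0 with h | h
  · refine ⟨-1, fun ε δ => ?_⟩
    rcases Int.units_eq_one_or ε with rfl | rfl <;> rcases Int.units_eq_one_or δ with rfl | rfl <;>
      simp [IsPosCorner, IsNegCorner, underRay, overRay, hneg, h, h.le, hne, hne.symm,
        Units.smul_def]
  · refine ⟨1, fun ε δ => ?_⟩
    rcases Int.units_eq_one_or ε with rfl | rfl <;> rcases Int.units_eq_one_or δ with rfl | rfl <;>
      simp [IsPosCorner, IsNegCorner, underRay, overRay, hneg, h, h.le, hne, hne.symm,
        Units.smul_def]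

lemma Crossing.linearIndependent_velocity (x : D.Crossing) :
    LinearIndependent ℝ ![D.velocity x.underParam, D.velocity x.overParam] :=
  D.transverse x.underParam x.overParam x.ne.symm x.curve_eq.symm

lemma contDiff_line (D : KnotDiagram S) : ContDiff ℝ 1 D.line := D.smooth.of_le (by simp)

end Sign

/-! ### The plane -/

/-- The plane is its own chart. -/
noncomputable def planeChart (D : KnotDiagram plane) : PlanarChart D where
  toPlane := Complex.orthonormalBasisOneI.repr.symm
  ofPlane := Complex.orthonormalBasisOneI.repr
  pole := ∅
  isClosed_pole := isClosed_empty
  ofPlane_mem _ := ⟨mem_univ _, notMem_empty _⟩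
  left_inv z := LinearIsometryEquiv.symm_apply_apply _ z
  right_inv y _ := LinearIsometryEquiv.apply_symm_apply _ y
  differentiable_ofPlane := Complex.orthonormalBasisOneI.repr.differentiable
  continuousAt_toPlane _ _ := Complex.orthonormalBasisOneI.repr.symm.continuous.continuousAt
  differentiableAt_toPlane _ := Complex.orthonormalBasisOneI.repr.symm.differentiableAt
  curve_notMem_pole _ := notMem_empty _
  smooth := Complex.orthonormalBasisOneI.repr.symm.contDiff.comp D.contDiff_line

lemma plane_exists_hasSign {D : KnotDiagram plane} (x : D.Crossing) : ∃ κ, x.HasSign κ := by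
  refine x.exists_hasSign (fun h => ?_) fun v w => ?_
  · have hli := x.linearIndependent_velocity
    rw [LinearIndependent.pair_iff] at hli
    obtain ⟨c, hc, hc0⟩ := Matrix.exists_vecMul_eq_zero_iff.2 h
    have h0 := congrFun hc0 0
    have h1 := congrFun hc0 1
    simp [Matrix.vecMul, dotProduct, Fin.sum_univ_two] at h0 h1
    obtain ⟨e0, e1⟩ := hli (c 0) (c 1) (by ext i; fin_cases i <;> simpa)
    exact hc (by ext i; fin_cases i <;> simpa)
  · simp only [plane, Matrix.det_fin_two_of, PiLp.neg_apply]
    constructor <;> ring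

/-! ### The sphere -/

lemma sphere_norm_line (D : KnotDiagram sphere) (t : ℝ) : ‖D.line t‖ = 1 :=
  mem_sphere_zero_iff_norm.1 (D.mem_carrier _)

lemma sphere_inner_velocity (D : KnotDiagram sphere) (t : ℝ) :
    inner ℝ (D.line t) (D.velocity (t : UnitAddCircle)) = 0 := by
  have h := (D.hasDerivAt_line t).inner ℝ (D.hasDerivAt_line t)
  have hc : (fun t => inner ℝ (D.line t) (D.line t)) = fun _ => (1 : ℝ) := by
    funext t
    rw [real_inner_self_eq_norm_sq, sphere_norm_line, one_pow]
  rw [hc] at h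
  have := h.unique (hasDerivAt_const t (1 : ℝ))
  rw [real_inner_comm (D.line t)] at this
  linarith

/-- On the sphere velocities are orthogonal to the position vector, so a vanishing determinant would
give a linear relation between the two velocities alone, against transversality. -/
lemma sphere_exists_hasSign {D : KnotDiagram sphere} (x : D.Crossing) : ∃ κ, x.HasSign κ := by
  refine x.exists_hasSign (fun h => ?_) fun v w => ?_
  · have hli := x.linearIndependent_velocity
    rw [LinearIndependent.pair_iff] at hli
    have hp : inner ℝ x.point x.point = (1 : ℝ) := by
      rw [← x.line_lo, real_inner_self_eq_norm_sq, sphere_norm_line, one_pow]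
    have hort : ∀ s, D.curve s = x.point → inner ℝ x.point (D.velocity s) = 0 := by
      intro s hs
      obtain ⟨t, rfl⟩ := QuotientAddGroup.mk_surjective s
      rw [← hs]
      exact sphere_inner_velocity D t
    have hu := hort _ x.curve_eq.symm
    have ho := hort x.overParam rfl
    obtain ⟨c, hc, hc0⟩ := Matrix.exists_vecMul_eq_zero_iff.2 h
    have hsum : c 0 • x.point + c 1 • D.velocity x.underParam + c 2 • D.velocity x.overParam = 0 := by
      ext i
      have := congrFun hc0 i
      fin_cases i <;> simpa [Matrix.vecMul, dotProduct, Fin.sum_univ_three] using this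
    have e0 : c 0 = 0 := by
      have := congrArg (fun y => inner ℝ x.point y) hsum
      simpa only [inner_add_right, inner_smul_right, hu, ho, hp, mul_zero, add_zero, mul_one,
        inner_zero_right] using this
    rw [e0, zero_smul, zero_add] at hsum
    obtain ⟨e1, e2⟩ := hli (c 1) (c 2) hsum
    exact hc (by ext i; fin_cases i <;> simpa)
  · simp only [sphere, Matrix.det_fin_three, Matrix.of_apply, Matrix.cons_val, PiLp.neg_apply]
    constructor <;> ring

/-- A smooth closed curve does not fill the sphere. -/
lemma sphere_exists_notMem (D : KnotDiagram sphere) :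
    ∃ v : EuclideanSpace ℝ (Fin 3), ‖v‖ = 1 ∧ ∀ s, D.curve s ≠ v := by
  -- The cone over the curve is a `C¹` image of a plane in three-space, so its complement is dense;
  -- a point missed by the cone, once normalized, is missed by the curve.
  have hs : ContDiff ℝ 1 fun q : ℝ × ℝ => q.1 • D.line q.2 :=
    contDiff_fst.smul (D.contDiff_line.comp contDiff_snd)
  obtain ⟨z, hz⟩ := (hs.dense_compl_range_of_finrank_lt_finrank (by simp)).nonempty
  have hz0 : z ≠ 0 := by
    rintro rfl
    exact hz ⟨(0, 0), by simp⟩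
  refine ⟨‖z‖⁻¹ • z, by simp [norm_smul, hz0], fun s h => hz ?_⟩
  obtain ⟨t, rfl⟩ := QuotientAddGroup.mk_surjective s
  refine ⟨(‖z‖, t), ?_⟩
  change ‖z‖ • D.curve _ = z
  erw [h]
  rw [smul_inv_smul₀ (norm_ne_zero_iff.2 hz0)]

lemma inner_ne_one {v y : EuclideanSpace ℝ (Fin 3)} (hv : ‖v‖ = 1) (hy : ‖y‖ = 1) (h : y ≠ v) :
    innerSL ℝ v y ≠ (1 : ℝ) :=
  ((inner_lt_one_iff_real_of_norm_eq_one hv hy).2 h.symm).ne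

/-- The stereographic projection from a unit vector off the curve. -/
noncomputable def sphereChart (D : KnotDiagram sphere) {v : EuclideanSpace ℝ (Fin 3)}
    (hv : ‖v‖ = 1) (hD : ∀ s, D.curve s ≠ v)
    (L : (Submodule.span ℝ {v})ᗮ ≃L[ℝ] ℂ) : PlanarChart D where
  toPlane y := L (stereoToFun v y)
  ofPlane z := stereoInvFun hv (L.symm z)
  pole := {v}
  isClosed_pole := isClosed_singleton
  ofPlane_mem z := ⟨(stereoInvFun hv (L.symm z)).2, fun h =>
    stereoInvFun_ne_north_pole hv (L.symm z) (Subtype.ext h)⟩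
  left_inv z := by rw [stereo_right_inv, L.apply_symm_apply]
  right_inv y hy := by
    rw [L.symm_apply_apply]
    exact congrArg Subtype.val (stereo_left_inv hv (x := ⟨y, hy.1⟩) hy.2)
  differentiable_ofPlane :=
    ((contDiff_stereoInvFunAux (m := 1)).differentiable one_ne_zero).comp
      ((Submodule.subtypeL _).differentiable.comp L.symm.differentiable)
  continuousAt_toPlane y hy := by
    refine L.continuous.continuousAt.comp (continuousOn_stereoToFun.continuousAt ?_)
    exact (isOpen_ne_fun (innerSL ℝ v).continuous continuous_const).mem_nhds
      (inner_ne_one hv (mem_sphere_zero_iff_norm.1 hy.1) hy.2)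
  differentiableAt_toPlane s := by
    refine L.differentiableAt.comp _ ((contDiffOn_stereoToFun (n := 1)).contDiffAt ?_
      |>.differentiableAt one_ne_zero)
    exact (isOpen_ne_fun (innerSL ℝ v).continuous continuous_const).mem_nhds
      (inner_ne_one hv (mem_sphere_zero_iff_norm.1 (D.mem_carrier s)) (hD s))
  curve_notMem_pole s := hD s
  smooth := L.contDiff.comp (contDiffOn_stereoToFun.comp_contDiff D.contDiff_line fun t =>
    inner_ne_one hv (mem_sphere_zero_iff_norm.1 (D.mem_carrier t)) (hD t))

lemma sphere_nonempty_planarChart (D : KnotDiagram sphere) : Nonempty (PlanarChart D) := by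
  obtain ⟨v, hv, hD⟩ := sphere_exists_notMem D
  have hv0 : v ≠ 0 := by
    rintro rfl
    simp at hv
  have : Fact (Module.finrank ℝ (EuclideanSpace ℝ (Fin 3)) = 2 + 1) := ⟨by simp⟩
  have hr : Module.finrank ℝ (Submodule.span ℝ {v})ᗮ = Module.finrank ℝ ℂ := by
    rw [Submodule.finrank_orthogonal_span_singleton (n := 2) hv0, Complex.finrank_real_complex]
  exact ⟨sphereChart D hv hD (ContinuousLinearEquiv.ofFinrankEq hr)⟩

end KnotDiagram

end

theorem mainTheorem10 :
    (∀ (D : KnotDiagram plane) (n : ℕ) (_ : 1 ≤ n) (x : Fin n ≃ D.Crossing),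
      (∀ c : Fin n → ℤ, ∃ u : D.Region →₀ ℤ, matMul (D.alternatingSingle x) u + c = 0) ∧
      (∀ c : Fin n → ℤ, ∃ u : D.Region →₀ ℤ, matMul (D.alternatingDouble x) u + c = 0)) ∧
    (∀ (D : KnotDiagram sphere) (n : ℕ) (_ : 1 ≤ n) (x : Fin n ≃ D.Crossing),
      (∀ c : Fin n → ℤ, ∃ u : D.Region →₀ ℤ, matMul (D.alternatingSingle x) u + c = 0) ∧
      (∀ c : Fin n → ℤ, ∃ u : D.Region →₀ ℤ, matMul (D.alternatingDouble x) u + c = 0)) := by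
  refine ⟨fun D n _ x => ?_, fun D n _ x => ?_⟩
  · exact KnotDiagram.solvable_of_planarChart (KnotDiagram.planeChart D)
      KnotDiagram.plane_exists_hasSign x
  · obtain ⟨C⟩ := KnotDiagram.sphere_nonempty_planarChart D
    exact KnotDiagram.solvable_of_planarChart C KnotDiagram.sphere_exists_hasSign x
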